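/- **Proposition (Holonomy of $\mathrm{Sym}(2,\mathbb R)$).** Let $\mathrm{Sym}(2,\mathbb R)$ be the space of real symmetric $2\times2$ matrices with the global chart $\begin{pmatrix}x+z&y\\y&-x+z\end{pmatrix}\mapsto(x,y,z)$, let $L=\{x=y=0\}$ be the line of scalar matrices, and let $(r,\phi,z)$ be the cylindrical coordinates of $(x,y,z)$. Away from $L$ consider the Riemannian metric $$g=\begin{pmatrix}1+3x^2/r^2&3xy/r^2&0\\3xy/r^2&1+3y^2/r^2&0\\0&0&1\end{pmatrix}$$ with its Levi-Civita connection $\nabla$, and the $g$-orthonormal frame $e_1=\cos\phi\,\frac{\partial_r}{2}-\sin\phi\,\frac{\partial_\phi}{r}$, $e_2=\sin\phi\,\frac{\partial_r}{2}+\cos\phi\,\frac{\partial_\phi}{r}$, $e_3=\partial_z$. Fix a base point $p\in \mathrm{Sym}(2,\mathbb R)\setminus L$. A *loop* at $p$ is a piecewise smooth closed curve $\gamma:[0,1]\to\mathrm{Sym}(2,\mathbb R)$ with $\gamma(0)=\gamma(1)=p$ which may cross $L$, but only at times where it is smooth and its velocity is not tangent to $L$. Its winding number around $L$ is $W(\gamma;L)=\frac1{2\pi}\int_\gamma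 d\phi$. A vector field $E$ along $\gamma$ is *parallel* if, away from $L$, it is continuous and satisfies $\nabla_{\gamma'}E=0$ wherever $\gamma$ is differentiable, and if, at each crossing of $L$, its components in the frame $(e_1,e_2,e_3)$ extend continuously. For $U=\mathrm{Sym}(2,\mathbb R)\setminus L$ or $U=\mathrm{Sym}(2,\mathbb R)$, the holonomy group $\mathrm{Hol}_p(U)$ is the group generated by the parallel transports $T_p\to T_p$ along the loops at $p$ that stay in $U$. Let $R_p(\theta)$ be the rotation of the tangent space $T_p$ by the angle $\theta$ in the plane of $e_1,e_2$ (from $e_1$ towards $e_2$) that fixes $e_3$. Then: 0. For every loop $\gamma$ at $p$, the integral defining $W(\gamma;L)$ converges absolutely, and the parallel transport along $\gamma$ exists, is unique, and equals $R_p(\pi\, W(\gamma;L))$. 1. $\mathrm{Hol}_p(\mathrm{Sym}(2,\mathbb R)\setminus L)=\{R_p(k\pi):k\in\mathbb Z\}\cong\mathbb Z_2$. 2. $\mathrm{Hol}_p(\mathrm{Sym}(2,\mathbb R))=\{R_p(k\pi/2):k\in\mathbb Z\}\cong\mathbb Z_4$. In both cases every element of the holonomy group is the parallel transport along a single loop at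 $p$ in $U$. -/

import Mathlib

open scoped ContDiff Topology

noncomputable section

namespace SymHol

/-- The space `Sym(2,ℝ)` of real symmetric 2-by-2 matrices. -/
abbrev SymMat : Type := {A : Matrix (Fin 2) (Fin 2) ℝ // A.IsSymm}

/-- Coordinate vectors; also the tangent spaces, in the basis `∂_x, ∂_y, ∂_z` of the chart. -/
abbrev V : Type := Fin 3 → ℝ

/-- The global cartesian chart `!![x + z, y; y, -x + z] ↦ (x, y, z)`. -/
def chart : SymMat ≃ V where
  toFun A := ![(A.1 0 0 - A.1 1 1) / 2, A.1 0 1, (A.1 0 0 + A.1 1 1) / 2]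
  invFun q := ⟨!![q 0 + q 2, q 1; q 1, -q 0 + q 2], by
    ext i j; fin_cases i <;> fin_cases j <;> simp⟩
  left_inv A := by
    have h : A.1 1 0 = A.1 0 1 := A.2.apply 0 1
    ext i j
    fin_cases i <;> fin_cases j <;> simp [h] <;> ring
  right_inv q := by
    ext i
    fin_cases i <;> simp <;> ring

/-- The singular line `L` of scalar matrices. -/
def L : Set SymMat := {A | ∃ c : ℝ, A.1 = c • (1 : Matrix (Fin 2) (Fin 2) ℝ)}

/-- `r² = x² + y²`. -/
def rSq (q : V) : ℝ := q 0 ^ 2 + q 1 ^ 2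

/-- The metric tensor in the chart; it is smooth away from `L`. -/
def metric (q : V) : Matrix (Fin 3) (Fin 3) ℝ :=
  !![1 + 3 * q 0 ^ 2 / rSq q, 3 * q 0 * q 1 / rSq q, 0;
     3 * q 0 * q 1 / rSq q, 1 + 3 * q 1 ^ 2 / rSq q, 0;
     0, 0, 1]

/-- The scalar product `g(v, w)` of tangent vectors at the point with coordinates `q`. -/
def gInner (q v w : V) : ℝ := ∑ i, ∑ j, metric q i j * v i * w j

/-- The partial derivative `∂_i f` at `q`. -/
def partialDeriv (i : Fin 3) (f : V → ℝ) (q : V) : ℝ := fderiv ℝ f q (Pi.single i 1)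

/-- The Christoffel symbol `Γ^k_{ij}` of the Levi-Civita connection of the metric. -/
def christoffel (k i j : Fin 3) (q : V) : ℝ :=
  (1 / 2) * ∑ l, (metric q)⁻¹ k l *
    (partialDeriv i (fun p => metric p j l) q + partialDeriv j (fun p => metric p i l) q
      - partialDeriv l (fun p => metric p i j) q)

/-- The reference frame, orthonormal for the metric away from `L`. With cylindrical coordinates
`(r, φ, z)`: `e₁ = cos φ (∂_r / 2) - sin φ (∂_φ / r)`, `e₂ = sin φ (∂_r / 2) + cos φ (∂_φ / r)`,
`e₃ = ∂_z`. -/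
def frame (q : V) : Fin 3 → V :=
  ![![(q 0 ^ 2 / 2 + q 1 ^ 2) / rSq q, -(q 0 * q 1) / (2 * rSq q), 0],
    ![-(q 0 * q 1) / (2 * rSq q), (q 1 ^ 2 / 2 + q 0 ^ 2) / rSq q, 0],
    ![0, 0, 1]]

/-- The components `g(e_i, v)` of a tangent vector at `q` in the reference frame. -/
def frameComponents (q v : V) : Fin 3 → ℝ := fun i => gInner q (frame q i) v

/-- The curve `γ`, read in the chart. -/
def chartCurve (γ : ℝ → SymMat) : ℝ → V := fun t => chart (γ t)

/-- The velocity `γ'(t)` of a curve, in the chart. -/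
def velocity (γ : ℝ → SymMat) (t : ℝ) : V := deriv (chartCurve γ) t

/-- A piecewise smooth loop `γ : [0, 1] → Sym(2,ℝ)` at `p`, which may cross `L`, but only
at times where it is smooth and where its velocity is not tangent to `L`. -/
structure IsLoopAt (p : SymMat) (γ : ℝ → SymMat) : Prop where
  source : γ 0 = p
  target : γ 1 = p
  piecewise_smooth : ∃ (n : ℕ) (s : ℕ → ℝ), Monotone s ∧ s 0 = 0 ∧ s n = 1 ∧
    (∀ i < n, ContDiffOn ℝ ∞ (chartCurve γ) (Set.Icc (s i) (s (i + 1)))) ∧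
    ∀ i ≤ n, γ (s i) ∉ L
  transverse : ∀ t ∈ Set.Ioo (0 : ℝ) 1, γ t ∈ L → velocity γ t 0 ≠ 0 ∨ velocity γ t 1 ≠ 0

/-- `E` is a parallel vector field along `γ : [0, 1] → Sym(2,ℝ)`: away from `L` it is continuous
and solves `∇_{γ'} E = 0` wherever `γ` is differentiable; where `γ` crosses `L`, its components
in the reference frame extend continuously. -/
structure IsParallelAlong (γ : ℝ → SymMat) (E : ℝ → V) : Prop where
  continuous : ∀ t ∈ Set.Icc (0 : ℝ) 1, γ t ∉ L → ContinuousWithinAt E (Set.Icc 0 1) t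
  parallel : ∀ t ∈ Set.Ioo (0 : ℝ) 1, γ t ∉ L → DifferentiableAt ℝ (chartCurve γ) t →
    HasDerivAt E
      (fun k => -∑ i, ∑ j, christoffel k i j (chartCurve γ t) * velocity γ t i * E t j) t
  crossing : ∀ t ∈ Set.Ioo (0 : ℝ) 1, γ t ∈ L →
    ∃ c : Fin 3 → ℝ,
      Filter.Tendsto (fun u => frameComponents (chartCurve γ u) (E u)) (𝓝[≠] t) (𝓝 c)

/-- `T` is the parallel transport along `γ` from the tangent space at `γ 0` to that at `γ 1`. -/
def IsParallelTransport (γ : ℝ → SymMat) (T : V →ₗ[ℝ] V) : Prop :=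
  ∀ v : V, ∃ E : ℝ → V, IsParallelAlong γ E ∧ E 0 = v ∧ E 1 = T v

/-- The parallel transports around loops at `p` that stay in `U`. -/
def loopTransports (U : Set SymMat) (p : SymMat) : Set (V ≃ₗ[ℝ] V) :=
  {T | ∃ γ : ℝ → SymMat, IsLoopAt p γ ∧ (∀ t ∈ Set.Icc (0 : ℝ) 1, γ t ∈ U) ∧
    IsParallelTransport γ (T : V →ₗ[ℝ] V)}

/-- The holonomy group of `U` at `p`. -/
def holonomyGroup (U : Set SymMat) (p : SymMat) : Subgroup (V ≃ₗ[ℝ] V) :=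
  Subgroup.closure (loopTransports U p)

/-- The angular form `dφ = (x dy - y dx) / r²` on `v`, at `q`. -/
def dphi (q v : V) : ℝ := (q 0 * v 1 - q 1 * v 0) / rSq q

/-- The winding number of `γ` around `L`; it need not be an integer if `γ` crosses `L`. -/
def windingNumber (γ : ℝ → SymMat) : ℝ :=
  (1 / (2 * Real.pi)) * ∫ t in (0 : ℝ)..1, dphi (chartCurve γ t) (velocity γ t)

/-- The rotation by the angle `θ` of the tangent space at `p` in the plane of `e₁, e₂` (from `e₁`
towards `e₂`), fixing `e₃`. -/
def rotation (p : SymMat) (θ : ℝ) : V →ₗ[ℝ] V where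
  toFun v :=
    let c := frameComponents (chart p) v
    (Real.cos θ * c 0 - Real.sin θ * c 1) • frame (chart p) 0
      + (Real.sin θ * c 0 + Real.cos θ * c 1) • frame (chart p) 1
      + c 2 • frame (chart p) 2
  map_add' v w := by
    ext i
    simp [frameComponents, gInner, Fin.sum_univ_three]
    ring
  map_smul' a v := by
    ext i
    simp [frameComponents, gInner, Fin.sum_univ_three]
    ring

end SymHol

end

/-! In cylindrical coordinates the metric is `4 dr² + r² dφ² + dz²`. With `R = 2r` this is a flat
cone of total angle `π` times a line. Hence the frame `e₁, e₂` turns by `-dφ/2` against parallel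
fields: the components of a parallel field rotate by `dφ/2` (`hasDerivAt_ofComponents`,
`hasDerivAt_frameComponents`), and transport is rotation by half the swept angle, which is `π W`.

The argument survives crossings of `L` because they are transverse: both `x y' - y x'` and `r²` are
of second order in the time from the crossing, the latter bounded below
(`eventually_abs_angular_le`). So `dφ` is integrable along the curve, the swept angle is continuous,
and it gives the continuous extension of the components. Crossings are isolated, hence finite in
number, so a quantity with zero derivative off `L` and limits at crossings has equal end values
(`eq_of_hasDerivAt_zero`). This gives uniqueness.

The same principle quantizes the angle. The unit horizontal direction turned back by the swept angle
is locally constant off `L` and only changes sign at a crossing. So the total angle lies in `2πℤ`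
for loops avoiding `L`, and in `πℤ` in general, since the square has limits at crossings. Explicit
spirals attain every such value, so the transports are the powers of a rotation of order 2 or 4. -/

open scoped ContDiff Topology

noncomputable section

namespace SymHol

/-! ### The metric, its Christoffel symbols and the frame -/

/-- The part `(x, y, 0)` of a coordinate vector orthogonal to the axis. -/
def horiz (q : V) : V := ![q 0, q 1, 0]

/-- The vector `(-y, x, 0)`. -/
def perp (q : V) : V := ![-q 1, q 0, 0]

theorem mem_L_iff (A : SymMat) : A ∈ L ↔ rSq (chart A) = 0 := by
  have h10 : A.1 1 0 = A.1 0 1 := A.2.apply 0 1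
  constructor
  · rintro ⟨c, hc⟩
    simp [rSq, chart, hc]
  · intro h
    have h0 : (chart A) 0 = 0 := by
      unfold rSq at h
      nlinarith [sq_nonneg (chart A 0), sq_nonneg (chart A 1)]
    have h1 : (chart A) 1 = 0 := by
      unfold rSq at h
      nlinarith [sq_nonneg (chart A 0), sq_nonneg (chart A 1)]
    simp only [chart, Equiv.coe_fn_mk, Matrix.cons_val_zero, Matrix.cons_val_one] at h0 h1
    refine ⟨A.1 0 0, ?_⟩
    ext i j
    fin_cases i <;> fin_cases j <;> simp [h10, h1]
    linarith

theorem notMem_L_iff (A : SymMat) : A ∉ L ↔ rSq (chart A) ≠ 0 := (mem_L_iff A).not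

theorem metric_eq (q : V) (i j : Fin 3) :
    metric q i j = (1 : Matrix (Fin 3) (Fin 3) ℝ) i j + 3 * horiz q i * horiz q j / rSq q := by
  fin_cases i <;> fin_cases j <;> simp [metric, horiz] <;> ring

/-- The metric is `1 + 3 n nᵀ` with `n` the unit horizontal radial vector, so its inverse is `1 -
(3/4) n nᵀ`. -/
theorem metric_inv {q : V} (hq : rSq q ≠ 0) :
    (metric q)⁻¹ = !![1 - 3 / 4 * q 0 ^ 2 / rSq q, -(3 / 4 * q 0 * q 1 / rSq q), 0;
      -(3 / 4 * q 0 * q 1 / rSq q), 1 - 3 / 4 * q 1 ^ 2 / rSq q, 0; 0, 0, 1] := by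
  apply Matrix.inv_eq_right_inv
  unfold rSq at hq
  ext i j
  fin_cases i <;> fin_cases j <;>
    simp [metric, Matrix.mul_apply, Fin.sum_univ_three, rSq] <;> field_simp <;> ring

theorem partialDeriv_metric {q : V} (hq : rSq q ≠ 0) (k i j : Fin 3) :
    partialDeriv k (fun p => metric p i j) q =
      3 * (horiz (Pi.single k 1) i * horiz q j + horiz q i * horiz (Pi.single k 1) j) / rSq q
        - 6 * horiz q i * horiz q j * horiz q k / rSq q ^ 2 := by
  have hp : ∀ l : Fin 3, HasFDerivAt (fun p : V => p l)
      (ContinuousLinearMap.proj (R := ℝ) (φ := fun _ : Fin 3 => ℝ) l) q :=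
    fun l => (ContinuousLinearMap.proj (R := ℝ) (φ := fun _ : Fin 3 => ℝ) l).hasFDerivAt
  have hh : ∀ l : Fin 3, ∃ D : V →L[ℝ] ℝ, HasFDerivAt (fun p : V => horiz p l) D q ∧
      ∀ v, D v = horiz v l := by
    intro l
    fin_cases l
    · exact ⟨_, hp 0, fun v => rfl⟩
    · exact ⟨_, hp 1, fun v => rfl⟩
    · exact ⟨0, hasFDerivAt_const 0 q, fun v => rfl⟩
  obtain ⟨Di, hDi, hDi'⟩ := hh i
  obtain ⟨Dj, hDj, hDj'⟩ := hh j
  have hr : HasFDerivAt rSq _ q := ((hp 0).pow 2).add ((hp 1).pow 2)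
  have hm := (((hDi.const_mul 3).mul hDj).mul ((hasFDerivAt_inv hq).comp q hr)).const_add
    ((1 : Matrix (Fin 3) (Fin 3) ℝ) i j)
  have he : (fun p => metric p i j) = fun p : V => (1 : Matrix (Fin 3) (Fin 3) ℝ) i j
      + 3 * horiz p i * horiz p j * (rSq p)⁻¹ := by
    funext p; rw [metric_eq, div_eq_mul_inv]
  -- The differential of `rSq / 2` on a basis vector, put into the form that appears in the claim.
  have hk : q 0 * (Pi.single k (1 : ℝ) : V) 0 + q 1 * (Pi.single k (1 : ℝ) : V) 1 = horiz q k := by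
    fin_cases k <;> simp [horiz]
  unfold partialDeriv
  rw [he]
  erw [hm.fderiv]
  simp [hDi', hDj']
  rw [← hk]
  field_simp
  ring

/-- The Christoffel symbols of the metric. -/
theorem christoffel_eq {q : V} (hq : rSq q ≠ 0) (k i j : Fin 3) :
    christoffel k i j q = 3 / 4 * horiz q k * perp q i * perp q j / rSq q ^ 2 := by
  unfold christoffel
  rw [Fin.sum_univ_three, metric_inv hq]
  simp only [partialDeriv_metric hq]
  unfold rSq at *
  fin_cases k <;> fin_cases i <;> fin_cases j <;>
    simp [horiz, perp] <;> field_simp <;> ring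

/-- The frame components, computed with the dual frame. -/
theorem frameComponents_eq {q : V} (hq : rSq q ≠ 0) (v : V) :
    frameComponents q v = ![((2 * q 0 ^ 2 + q 1 ^ 2) * v 0 + q 0 * q 1 * v 1) / rSq q,
      (q 0 * q 1 * v 0 + (q 0 ^ 2 + 2 * q 1 ^ 2) * v 1) / rSq q, v 2] := by
  unfold rSq at hq
  ext i
  fin_cases i <;>
    simp [frameComponents, gInner, Fin.sum_univ_three, frame, metric, rSq] <;> field_simp <;> ring

theorem frameComponents_frame {q : V} (hq : rSq q ≠ 0) (a : Fin 3 → ℝ) :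
    frameComponents q (a 0 • frame q 0 + a 1 • frame q 1 + a 2 • frame q 2) = a := by
  rw [frameComponents_eq hq]
  unfold rSq at *
  ext i
  fin_cases i <;> simp [frame, rSq] <;> field_simp <;> ring

theorem frame_frameComponents {q : V} (hq : rSq q ≠ 0) (v : V) :
    frameComponents q v 0 • frame q 0 + frameComponents q v 1 • frame q 1
      + frameComponents q v 2 • frame q 2 = v := by
  rw [frameComponents_eq hq]
  unfold rSq at *
  ext i
  fin_cases i <;> simp [frame, rSq] <;> field_simp <;> ring

/-- The connection applied to `v` in the direction `u`, without the derivative of `v`. -/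
theorem sum_christoffel {q : V} (hq : rSq q ≠ 0) (u v : V) (k : Fin 3) :
    ∑ i, ∑ j, christoffel k i j q * u i * v j = 3 / 4 * dphi q u * dphi q v * horiz q k := by
  simp only [christoffel_eq hq, Fin.sum_univ_three, dphi, perp]
  simp
  field_simp
  ring

/-! ### Loops: breakpoints, crossings of the axis, constancy -/

open Set Filter MeasureTheory

theorem exists_mem_Ico_of_monotone {s : ℕ → ℝ} (n : ℕ) {t : ℝ} (ht : t ∈ Ico (s 0) (s n)) :
    ∃ i < n, t ∈ Ico (s i) (s (i + 1)) := by
  induction n with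
  | zero => exact absurd (ht.1.trans_lt ht.2) (lt_irrefl _)
  | succ n ih =>
    by_cases h : t < s n
    · obtain ⟨i, hi, hti⟩ := ih ⟨ht.1, h⟩
      exact ⟨i, hi.trans n.lt_succ_self, hti⟩
    · exact ⟨n, n.lt_succ_self, not_lt.1 h, ht.2⟩

theorem continuousOn_Icc_of_pieces {X : Type*} [TopologicalSpace X] {f : ℝ → X} {s : ℕ → ℝ}
    (hs : Monotone s) (n : ℕ) (hf : ∀ i < n, ContinuousOn f (Icc (s i) (s (i + 1)))) :
    ContinuousOn f (Icc (s 0) (s n)) := by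
  induction n with
  | zero => simp
  | succ n ih =>
    rw [← Icc_union_Icc_eq_Icc (hs n.zero_le) (hs n.le_succ)]
    exact (ih fun i hi => hf i (hi.trans n.lt_succ_self)).union_of_isClosed
      (hf n n.lt_succ_self) isClosed_Icc isClosed_Icc

namespace IsLoopAt

variable {p : SymMat} {γ : ℝ → SymMat}

theorem continuousOn (h : IsLoopAt p γ) : ContinuousOn (chartCurve γ) (Icc 0 1) := by
  obtain ⟨n, s, hs, h0, h1, hd, -⟩ := h.piecewise_smooth
  rw [← h0, ← h1]
  exact continuousOn_Icc_of_pieces hs n fun i hi => (hd i hi).continuousOn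

/-- The finite set of breakpoints of a loop. -/
theorem exists_breakpoints (h : IsLoopAt p γ) : ∃ B : Set ℝ, B.Finite ∧
    (∀ t ∈ Icc (0 : ℝ) 1, t ∉ B → t ∈ Ioo (0 : ℝ) 1 ∧ ContDiffAt ℝ ∞ (chartCurve γ) t) ∧
    (∀ t ∈ B, γ t ∉ L) ∧ ∃ M, ∀ t ∈ Icc (0 : ℝ) 1, ‖velocity γ t‖ ≤ M := by
  obtain ⟨n, s, hs, h0, h1, hd, hL⟩ := h.piecewise_smooth
  have hfin : (s '' Iic n).Finite := (finite_Iic n).image s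
  have key : ∀ t ∈ Icc (0 : ℝ) 1, t ∉ s '' Iic n → ∃ i < n, t ∈ Ioo (s i) (s (i + 1)) := by
    intro t ht htB
    have hne : ∀ i ≤ n, t ≠ s i := fun i hi e => htB ⟨i, hi, e.symm⟩
    obtain ⟨i, hi, hti⟩ := exists_mem_Ico_of_monotone n
      (show t ∈ Ico (s 0) (s n) from ⟨h0 ▸ ht.1, (h1 ▸ ht.2).lt_of_ne (hne n le_rfl)⟩)
    exact ⟨i, hi, hti.1.lt_of_ne (hne i hi.le).symm, hti.2⟩
  refine ⟨s '' Iic n, hfin, ?_, ?_, ?_⟩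
  · intro t ht htB
    obtain ⟨i, hi, hti⟩ := key t ht htB
    exact ⟨⟨(h0 ▸ hs i.zero_le).trans_lt hti.1, hti.2.trans_le (h1 ▸ hs hi)⟩,
      (hd i hi).contDiffAt (Icc_mem_nhds hti.1 hti.2)⟩
  · rintro _ ⟨i, hi, rfl⟩
    exact hL i hi
  · have hb : ∀ i : ℕ, ∃ M, i < n → ∀ t ∈ Ioo (s i) (s (i + 1)), ‖velocity γ t‖ ≤ M := by
      intro i
      -- The partition is only monotone. A degenerate piece has empty interior, so any bound serves
      -- there.
      by_cases hi : i < n ∧ s i < s (i + 1)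
      · have hc := (hd i hi.1).continuousOn_derivWithin (uniqueDiffOn_Icc hi.2) (by simp)
        obtain ⟨M, hM⟩ := isCompact_Icc.exists_bound_of_continuousOn hc
        refine ⟨M, fun _ t ht => ?_⟩
        have := hM t (Ioo_subset_Icc_self ht)
        rwa [derivWithin_of_mem_nhds (Icc_mem_nhds ht.1 ht.2)] at this
      · exact ⟨0, fun hin t ht => absurd ⟨hin, ht.1.trans ht.2⟩ hi⟩
    choose M hM using hb
    obtain ⟨M₁, hM₁⟩ := ((Finset.range n).image M).exists_le
    -- At breakpoints `deriv` may be a default value; finiteness alone bounds it there.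
    obtain ⟨M₂, hM₂⟩ := (hfin.image fun t => ‖velocity γ t‖).bddAbove
    refine ⟨max M₁ M₂, fun t ht => ?_⟩
    by_cases htB : t ∈ s '' Iic n
    · exact (hM₂ ⟨t, htB, rfl⟩).trans (le_max_right _ _)
    · obtain ⟨i, hi, hti⟩ := key t ht htB
      exact (hM i hi t hti).trans ((hM₁ _ (Finset.mem_image_of_mem M (Finset.mem_range.2 hi))).trans
        (le_max_left _ _))

theorem zero_notMem (h : IsLoopAt p γ) (hp : p ∉ L) : γ 0 ∉ L := h.source.symm ▸ hp

theorem one_notMem (h : IsLoopAt p γ) (hp : p ∉ L) : γ 1 ∉ L := h.target.symm ▸ hp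

theorem mem_Ioo_of_mem_L (h : IsLoopAt p γ) (hp : p ∉ L) {t : ℝ} (ht : t ∈ Icc (0 : ℝ) 1)
    (hL : γ t ∈ L) : t ∈ Ioo (0 : ℝ) 1 :=
  ⟨ht.1.lt_of_ne fun e => h.zero_notMem hp (e ▸ hL),
    ht.2.lt_of_ne fun e => h.one_notMem hp (e ▸ hL)⟩

/-- Breakpoints stay off `L`, so every crossing lies in the interior of a smooth piece. -/
theorem contDiffAt_of_mem_L (h : IsLoopAt p γ) {t : ℝ} (ht : t ∈ Ioo (0 : ℝ) 1)
    (hL : γ t ∈ L) : ContDiffAt ℝ ∞ (chartCurve γ) t := by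
  obtain ⟨B, -, hB, hBL, -⟩ := h.exists_breakpoints
  exact (hB t (Ioo_subset_Icc_self ht) fun htB => hBL t htB hL).2

end IsLoopAt

theorem continuous_rSq : Continuous rSq := by unfold rSq; fun_prop

theorem rSq_eq_zero_iff (q : V) : rSq q = 0 ↔ q 0 = 0 ∧ q 1 = 0 := by
  unfold rSq
  constructor
  · intro h
    constructor <;> nlinarith [sq_nonneg (q 0), sq_nonneg (q 1)]
  · rintro ⟨h0, h1⟩
    simp [h0, h1]

theorem rSq_nonneg (q : V) : 0 ≤ rSq q := by unfold rSq; positivity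

theorem hasDerivAt_chartCurve_apply {γ : ℝ → SymMat} {t : ℝ}
    (h : DifferentiableAt ℝ (chartCurve γ) t) (i : Fin 3) :
    HasDerivAt (fun u => chartCurve γ u i) (velocity γ t i) t :=
  hasDerivAt_pi.1 h.hasDerivAt i

namespace IsLoopAt

variable {p : SymMat} {γ : ℝ → SymMat}

theorem eventually_notMem_L (h : IsLoopAt p γ) {t : ℝ} (ht : t ∈ Icc (0 : ℝ) 1) (hL : γ t ∉ L) :
    ∀ᶠ u in 𝓝[Icc 0 1] t, γ u ∉ L := by
  have hc : ContinuousWithinAt (fun u => rSq (chartCurve γ u)) (Icc 0 1) t :=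
    continuous_rSq.continuousAt.comp_continuousWithinAt (h.continuousOn t ht)
  filter_upwards [hc.eventually_ne ((notMem_L_iff _).1 hL)] with u hu
  exact (notMem_L_iff _).2 hu

/-- Crossings of the axis are isolated. -/
theorem eventually_notMem_L_of_mem (h : IsLoopAt p γ) {t : ℝ} (ht : t ∈ Ioo (0 : ℝ) 1)
    (hL : γ t ∈ L) : ∀ᶠ u in 𝓝[≠] t, γ u ∉ L := by
  have hd := (h.contDiffAt_of_mem_L ht hL).differentiableAt (by simp)
  rcases h.transverse t ht hL with hv | hv
  · filter_upwards [(hasDerivAt_chartCurve_apply hd 0).eventually_ne hv (c := 0)] with u hu huL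
    exact hu ((rSq_eq_zero_iff _).1 ((mem_L_iff _).1 huL)).1
  · filter_upwards [(hasDerivAt_chartCurve_apply hd 1).eventually_ne hv (c := 0)] with u hu huL
    exact hu ((rSq_eq_zero_iff _).1 ((mem_L_iff _).1 huL)).2

/-- An infinite set of crossings would accumulate in `[0, 1]`. On `L` this contradicts isolation;
off `L` it contradicts that the complement of `L` is open. -/
theorem finite_crossings (h : IsLoopAt p γ) (hp : p ∉ L) :
    {t ∈ Icc (0 : ℝ) 1 | γ t ∈ L}.Finite := by
  by_contra hinf
  obtain ⟨t, ht, hacc⟩ := Set.Infinite.exists_accPt_of_subset_isCompact hinf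
    (isCompact_Icc (a := (0 : ℝ)) (b := 1)) (fun t ht => ht.1)
  rw [accPt_iff_frequently_nhdsNE] at hacc
  by_cases hL : γ t ∈ L
  · exact hacc ((h.eventually_notMem_L_of_mem (h.mem_Ioo_of_mem_L hp ht hL) hL).mono
      fun u hu hu' => hu hu'.2)
  · have := eventually_nhdsWithin_iff.1 (h.eventually_notMem_L ht hL)
    exact hacc ((this.filter_mono nhdsWithin_le_nhds).mono fun u hu hu' => hu hu'.1 hu'.2)

/-- A function which is locally constant away from finitely many times, and has limits at the
crossings, takes the same value at both ends. -/
theorem eq_of_hasDerivAt_zero {F : Type*} [NormedAddCommGroup F] [NormedSpace ℝ F]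
    [CompleteSpace F] (h : IsLoopAt p γ) (hp : p ∉ L) (f : ℝ → F)
    (hc : ∀ t ∈ Icc (0 : ℝ) 1, γ t ∉ L → ContinuousWithinAt f (Icc 0 1) t)
    (hl : ∀ t ∈ Ioo (0 : ℝ) 1, γ t ∈ L → ∃ l, Tendsto f (𝓝[≠] t) (𝓝 l))
    (hd : ∀ t ∈ Ioo (0 : ℝ) 1, γ t ∉ L → DifferentiableAt ℝ (chartCurve γ) t → HasDerivAt f 0 t) :
    f 1 = f 0 := by
  classical
  obtain ⟨B, hBf, hB, hBL, -⟩ := h.exists_breakpoints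
  -- Nothing is assumed about the value of `f` at a crossing, so it is replaced there by the limit,
  -- which makes `g` continuous on `[0, 1]`.
  let g : ℝ → F := fun t => if ht : t ∈ Ioo (0 : ℝ) 1 ∧ γ t ∈ L then (hl t ht.1 ht.2).choose else f t
  have hgf : ∀ t, γ t ∉ L → g t = f t := fun t ht => dif_neg fun h' => ht h'.2
  have hgc : ContinuousOn g (Icc 0 1) := by
    intro t ht
    by_cases hL : γ t ∈ L
    · have ht' := h.mem_Ioo_of_mem_L hp ht hL
      have hgt : g t = (hl t ht' hL).choose := dif_pos ⟨ht', hL⟩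
      have hT : Tendsto g (𝓝[≠] t) (𝓝 (g t)) := by
        rw [hgt]
        refine (hl t ht' hL).choose_spec.congr' ?_
        filter_upwards [h.eventually_notMem_L_of_mem ht' hL] with u hu
        exact (hgf u hu).symm
      exact (continuousAt_iff_punctured_nhds.2 hT).continuousWithinAt
    · refine (hc t ht hL).congr_of_eventuallyEq ?_ (hgf t hL)
      filter_upwards [h.eventually_notMem_L ht hL] with u hu
      exact hgf u hu
  have hI := intervalIntegral.integral_zero (μ := volume) (a := (0 : ℝ)) (b := 1) (E := F)
  have := integral_eq_of_hasDerivAt_off_countable_of_le g (fun _ => (0 : F)) zero_le_one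
    (hBf.union (h.finite_crossings hp)).countable hgc ?_ (by simp)
  · rw [hI, hgf 1 (h.one_notMem hp), hgf 0 (h.zero_notMem hp)] at this
    exact (sub_eq_zero.1 this.symm)
  · rintro t ⟨ht, hts⟩
    have htI := Ioo_subset_Icc_self ht
    have hL : γ t ∉ L := fun hL => hts (Or.inr ⟨htI, hL⟩)
    have hD := (hB t htI fun hb => hts (Or.inl hb)).2.differentiableAt (by simp)
    refine (hd t ht hL hD).congr_of_eventuallyEq ?_
    have := h.eventually_notMem_L htI hL
    rw [nhdsWithin_eq_nhds.2 (Icc_mem_nhds ht.1 ht.2)] at this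
    filter_upwards [this] with u hu
    exact hgf u hu

end IsLoopAt

/-! ### The angular form near a transverse crossing -/

theorem contDiffAt_deriv {x : ℝ → ℝ} {t₀ : ℝ} (hx : ContDiffAt ℝ ∞ x t₀) :
    ContDiffAt ℝ ∞ (deriv x) t₀ :=
  (hx.fderiv_right (m := ∞) (by simp)).clm_apply (contDiffAt_const (c := (1 : ℝ)))

theorem eventually_differentiableAt {x : ℝ → ℝ} {t₀ : ℝ} (hx : ContDiffAt ℝ ∞ x t₀) :
    ∀ᶠ t in 𝓝 t₀, DifferentiableAt ℝ x t := by
  have h1 : ContDiffAt ℝ 1 x t₀ := hx.of_le (by simp)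
  filter_upwards [h1.eventually (by simp)] with t ht
  exact ht.differentiableAt (by simp)

/-- Second order comparison of a function vanishing at `t₀` with its derivative. -/
theorem eventually_abs_sub_mul_deriv_le {x : ℝ → ℝ} {t₀ : ℝ} (hx : ContDiffAt ℝ ∞ x t₀)
    (h0 : x t₀ = 0) :
    ∃ M, ∀ᶠ t in 𝓝 t₀, |x t - (t - t₀) * deriv x t| ≤ M * (t - t₀) ^ 2 := by
  have hx' := contDiffAt_deriv hx
  have hc : ContinuousAt (fun t => |deriv (deriv x) t|) t₀ :=
    (contDiffAt_deriv hx').continuousAt.abs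
  refine ⟨|deriv (deriv x) t₀| + 1, ?_⟩
  have hev := ((eventually_differentiableAt hx).and (eventually_differentiableAt hx')).and
    (hc.eventually_lt_const (lt_add_one _))
  obtain ⟨ε, hε, hball⟩ := Metric.eventually_nhds_iff.1 hev
  filter_upwards [Metric.ball_mem_nhds t₀ hε] with t ht
  have hsub : ∀ u ∈ uIcc t₀ t, dist u t₀ < ε ∧ |u - t₀| ≤ |t - t₀| := by
    intro u hu
    have := abs_sub_left_of_mem_uIcc hu
    rw [Metric.mem_ball, Real.dist_eq] at ht
    exact ⟨(Real.dist_eq u t₀).symm ▸ this.trans_lt ht, this⟩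
  -- Mean value inequality for `x - (u - t₀) x'`, which vanishes at `t₀` and has derivative `-(u -
  -- t₀) x''`. The `+ 1` in the constant leaves room to bound `x''` on a neighbourhood.
  have hmv := (convex_uIcc t₀ t).norm_image_sub_le_of_norm_hasDerivWithin_le
    (f := fun u => x u - (u - t₀) * deriv x u)
    (f' := fun u => deriv x u - (1 * deriv x u + (u - t₀) * deriv (deriv x) u))
    (C := (|deriv (deriv x) t₀| + 1) * |t - t₀|) ?_ ?_ left_mem_uIcc right_mem_uIcc
  · simp only [h0, sub_self, zero_mul, sub_zero, Real.norm_eq_abs] at hmv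
    rwa [mul_assoc, ← sq, sq_abs] at hmv
  · intro u hu
    obtain ⟨⟨h1, h2⟩, -⟩ := hball (hsub u hu).1
    exact (h1.hasDerivAt.sub
      (((hasDerivAt_id u).sub_const t₀).mul h2.hasDerivAt)).hasDerivWithinAt
  · intro u hu
    obtain ⟨-, h3⟩ := hball (hsub u hu).1
    have : deriv x u - (1 * deriv x u + (u - t₀) * deriv (deriv x) u)
        = -(deriv (deriv x) u * (u - t₀)) := by ring
    rw [this, norm_neg, Real.norm_eq_abs, abs_mul]
    exact mul_le_mul h3.le (hsub u hu).2 (abs_nonneg _) (by positivity)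

theorem tendsto_div_sub_of_hasDerivAt {x : ℝ → ℝ} {x' t₀ : ℝ} (hx : HasDerivAt x x' t₀)
    (h0 : x t₀ = 0) : Tendsto (fun t => x t / (t - t₀)) (𝓝[≠] t₀) (𝓝 x') := by
  refine (hasDerivAt_iff_tendsto_slope.1 hx).congr fun t => ?_
  rw [slope_def_field, h0, sub_zero]

/-- The angular form is bounded along a smooth curve which meets the axis transversally. -/
theorem eventually_abs_angular_le {x y : ℝ → ℝ} {t₀ : ℝ} (hx : ContDiffAt ℝ ∞ x t₀)
    (hy : ContDiffAt ℝ ∞ y t₀) (hx0 : x t₀ = 0) (hy0 : y t₀ = 0)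
    (hxy : deriv x t₀ ≠ 0 ∨ deriv y t₀ ≠ 0) :
    ∃ K, ∀ᶠ t in 𝓝 t₀,
      |(x t * deriv y t - y t * deriv x t) / (x t ^ 2 + y t ^ 2)| ≤ K := by
  obtain ⟨M, hM⟩ := eventually_abs_sub_mul_deriv_le hx hx0
  obtain ⟨N, hN⟩ := eventually_abs_sub_mul_deriv_le hy hy0
  have hxc : ContinuousAt (fun t => |deriv x t|) t₀ := (contDiffAt_deriv hx).continuousAt.abs
  have hyc : ContinuousAt (fun t => |deriv y t|) t₀ := (contDiffAt_deriv hy).continuousAt.abs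
  set a := |deriv x t₀| + 1
  set b := |deriv y t₀| + 1
  have ha := hxc.eventually_lt_const (lt_add_one _)
  have hb := hyc.eventually_lt_const (lt_add_one _)
  have hpos : 0 < deriv x t₀ ^ 2 + deriv y t₀ ^ 2 := by
    rcases hxy with h | h <;> positivity
  -- Since `r² / (t - t₀)²` tends to the squared horizontal speed, half of that speed is an eventual
  -- lower bound.
  set c := (deriv x t₀ ^ 2 + deriv y t₀ ^ 2) / 2
  have hc : 0 < c := half_pos hpos
  have hr := ((tendsto_div_sub_of_hasDerivAt (hx.differentiableAt (by simp)).hasDerivAt hx0).pow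
    2).add ((tendsto_div_sub_of_hasDerivAt (hy.differentiableAt (by simp)).hasDerivAt hy0).pow 2)
  have hr' := eventually_nhdsWithin_iff.1 (hr.eventually_const_lt (half_lt_self hpos))
  refine ⟨(|M| * b + |N| * a) / c, ?_⟩
  filter_upwards [hM, hN, ha, hb, hr'] with t hMt hNt hat hbt hrt
  -- At `t₀` itself the quotient is `0 / 0 = 0`.
  by_cases ht : t = t₀
  · have : 0 ≤ (|M| * b + |N| * a) / c := by positivity
    simpa [ht, hx0, hy0] using this
  · have hs : 0 < (t - t₀) ^ 2 := by
      have := sub_ne_zero.2 ht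
      positivity
    have h1 : c * (t - t₀) ^ 2 < x t ^ 2 + y t ^ 2 := by
      have := hrt ht
      rw [div_pow, div_pow, ← add_div, lt_div_iff₀ hs] at this
      exact this
    have hR : 0 < x t ^ 2 + y t ^ 2 := (mul_pos hc hs).trans h1
    have hnum : |x t * deriv y t - y t * deriv x t| ≤ (|M| * b + |N| * a) * (t - t₀) ^ 2 := by
      -- The products `(t - t₀) x' y'` cancel, leaving only the second-order remainders.
      have e : x t * deriv y t - y t * deriv x t =
        (x t - (t - t₀) * deriv x t) * deriv y t - (y t - (t - t₀) * deriv y t) * deriv x t := by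
        ring
      rw [e]
      refine (abs_sub _ _).trans ?_
      rw [abs_mul, abs_mul]
      have h2 : |x t - (t - t₀) * deriv x t| * |deriv y t| ≤ |M| * (t - t₀) ^ 2 * b :=
        mul_le_mul (hMt.trans (by gcongr; exact le_abs_self M)) hbt.le (abs_nonneg _) (by positivity)
      have h3 : |y t - (t - t₀) * deriv y t| * |deriv x t| ≤ |N| * (t - t₀) ^ 2 * a :=
        mul_le_mul (hNt.trans (by gcongr; exact le_abs_self N)) hat.le (abs_nonneg _) (by positivity)
      linarith
    rw [abs_div, abs_of_pos hR, div_le_div_iff₀ hR hc]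
    calc |x t * deriv y t - y t * deriv x t| * c
        ≤ (|M| * b + |N| * a) * (t - t₀) ^ 2 * c := by gcongr
      _ = (|M| * b + |N| * a) * (c * (t - t₀) ^ 2) := by ring
      _ ≤ (|M| * b + |N| * a) * (x t ^ 2 + y t ^ 2) := by gcongr

/-! ### Integrability of the angular velocity -/

/-- The integrand of the winding number. -/
def angularVelocity (γ : ℝ → SymMat) (t : ℝ) : ℝ := dphi (chartCurve γ t) (velocity γ t)

/-- The angle swept by `γ` up to time `t`. -/
def sweptAngle (γ : ℝ → SymMat) (t : ℝ) : ℝ := ∫ u in (0 : ℝ)..t, angularVelocity γ u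

theorem continuousAt_velocity {γ : ℝ → SymMat} {t : ℝ} (h : ContDiffAt ℝ ∞ (chartCurve γ) t) :
    ContinuousAt (velocity γ) t :=
  ((h.fderiv_right (m := ∞) (by simp)).clm_apply (contDiffAt_const (c := (1 : ℝ)))).continuousAt

theorem continuousAt_angularVelocity {γ : ℝ → SymMat} {t : ℝ}
    (h : ContDiffAt ℝ ∞ (chartCurve γ) t) (hL : γ t ∉ L) : ContinuousAt (angularVelocity γ) t := by
  have hc (i : Fin 3) : ContinuousAt (fun u => chartCurve γ u i) t :=
    (continuous_apply i).continuousAt.comp h.continuousAt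
  have hv (i : Fin 3) : ContinuousAt (fun u => velocity γ u i) t :=
    (continuous_apply i).continuousAt.comp (continuousAt_velocity h)
  exact (((hc 0).mul (hv 1)).sub ((hc 1).mul (hv 0))).div
    (continuous_rSq.continuousAt.comp h.continuousAt) ((notMem_L_iff _).1 hL)

namespace IsLoopAt

variable {p : SymMat} {γ : ℝ → SymMat}

/-- At a crossing this is the transversality estimate; elsewhere `r²` is bounded below nearby and
the velocity is bounded. -/
theorem eventually_angularVelocity_le (h : IsLoopAt p γ) (hp : p ∉ L) {t : ℝ}
    (ht : t ∈ Icc (0 : ℝ) 1) : ∃ K, ∀ᶠ u in 𝓝[Icc 0 1] t, |angularVelocity γ u| ≤ K := by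
  by_cases hL : γ t ∈ L
  · have ht' := h.mem_Ioo_of_mem_L hp ht hL
    have hc := h.contDiffAt_of_mem_L ht' hL
    have hd : ∀ᶠ u in 𝓝 t, DifferentiableAt ℝ (chartCurve γ) u := by
      have h1 : ContDiffAt ℝ 1 (chartCurve γ) t := hc.of_le (by simp)
      filter_upwards [h1.eventually (by simp)] with u hu
      exact hu.differentiableAt (by simp)
    have hz := (rSq_eq_zero_iff _).1 ((mem_L_iff _).1 hL)
    have hv : ∀ i, deriv (fun u => chartCurve γ u i) t = velocity γ t i := fun i =>
      (hasDerivAt_chartCurve_apply hd.self_of_nhds i).deriv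
    obtain ⟨K, hK⟩ := eventually_abs_angular_le (contDiffAt_pi.1 hc 0) (contDiffAt_pi.1 hc 1)
      hz.1 hz.2 (by rw [hv, hv]; exact h.transverse t ht' hL)
    refine ⟨K, nhdsWithin_le_nhds ?_⟩
    filter_upwards [hK, hd] with u hu hdu
    rw [(hasDerivAt_chartCurve_apply hdu 0).deriv, (hasDerivAt_chartCurve_apply hdu 1).deriv] at hu
    exact hu
  · obtain ⟨B, -, -, -, M, hM⟩ := h.exists_breakpoints
    have hcw := h.continuousOn t ht
    have hc (i : Fin 3) : ContinuousWithinAt (fun u => |chartCurve γ u i|) (Icc 0 1) t :=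
      ((continuous_apply i).continuousAt.comp_continuousWithinAt hcw).abs
    have hr : ContinuousWithinAt (fun u => rSq (chartCurve γ u)) (Icc 0 1) t :=
      continuous_rSq.continuousAt.comp_continuousWithinAt hcw
    have hr0 : 0 < rSq (chartCurve γ t) := (rSq_nonneg _).lt_of_ne' ((notMem_L_iff _).1 hL)
    have h0 := (hc 0).eventually_lt_const (lt_add_one _)
    have h1 := (hc 1).eventually_lt_const (lt_add_one _)
    refine ⟨((|chartCurve γ t 0| + 1) * M + (|chartCurve γ t 1| + 1) * M)
      / (rSq (chartCurve γ t) / 2), ?_⟩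
    filter_upwards [h0, h1, hr.eventually_const_lt (half_lt_self hr0), self_mem_nhdsWithin]
      with u h0 h1 hru hu
    have hv : ∀ i, |velocity γ u i| ≤ M := fun i => (norm_le_pi_norm _ i).trans (hM u hu)
    have hM0 : 0 ≤ M := (abs_nonneg _).trans (hv 0)
    unfold angularVelocity dphi
    rw [abs_div, abs_of_pos ((half_pos hr0).trans hru)]
    refine div_le_div₀ (by positivity) ?_ (half_pos hr0) hru.le
    refine (abs_sub _ _).trans ?_
    rw [abs_mul, abs_mul]
    exact add_le_add (mul_le_mul h0.le (hv 1) (abs_nonneg _) (by positivity))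
      (mul_le_mul h1.le (hv 0) (abs_nonneg _) (by positivity))

/-- Continuity off a finite set gives measurability, and local boundedness on a compact interval
gives integrability. -/
theorem integrableOn_angularVelocity (h : IsLoopAt p γ) (hp : p ∉ L) :
    IntegrableOn (angularVelocity γ) (Icc 0 1) := by
  obtain ⟨B, hBf, hB, -⟩ := h.exists_breakpoints
  set S := B ∪ {t ∈ Icc (0 : ℝ) 1 | γ t ∈ L}
  have hS : S.Finite := hBf.union (h.finite_crossings hp)
  have hcont : ContinuousOn (angularVelocity γ) (Icc 0 1 \ S) := by
    rintro t ⟨ht, htS⟩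
    exact (continuousAt_angularVelocity (hB t ht fun hb => htS (Or.inl hb)).2
      fun hL => htS (Or.inr ⟨ht, hL⟩)).continuousWithinAt
  have hmeas : AEStronglyMeasurable (angularVelocity γ) (volume.restrict (Icc 0 1)) := by
    have := hcont.aestronglyMeasurable (μ := volume)
      (measurableSet_Icc.diff hS.measurableSet)
    rwa [Measure.restrict_congr_set (sdiff_null_ae_eq_self (hS.measure_zero volume))] at this
  refine LocallyIntegrableOn.integrableOn_isCompact (fun t ht => ?_) isCompact_Icc
  obtain ⟨K, hK⟩ := h.eventually_angularVelocity_le hp ht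
  exact Measure.FiniteAtFilter.integrableAtFilter ⟨Icc 0 1, self_mem_nhdsWithin, hmeas⟩
    (volume.finiteAt_nhdsWithin _ _) ⟨K, hK⟩

theorem intervalIntegrable (h : IsLoopAt p γ) (hp : p ∉ L) {a b : ℝ} (ha : a ∈ Icc (0 : ℝ) 1)
    (hb : b ∈ Icc (0 : ℝ) 1) : IntervalIntegrable (angularVelocity γ) volume a b :=
  ((h.integrableOn_angularVelocity hp).mono_set (uIcc_subset_Icc ha hb)).intervalIntegrable

theorem continuousOn_sweptAngle (h : IsLoopAt p γ) (hp : p ∉ L) :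
    ContinuousOn (sweptAngle γ) (Icc 0 1) := by
  have := intervalIntegral.continuousOn_primitive_interval (μ := volume) (a := 0) (b := 1)
    (f := angularVelocity γ) (by rw [uIcc_of_le zero_le_one]; exact h.integrableOn_angularVelocity hp)
  rwa [uIcc_of_le zero_le_one] at this

end IsLoopAt

/-! ### The swept angle as a continuous argument -/

/-- The horizontal part of a coordinate vector, as a complex number. -/
def toComplex (q : V) : ℂ := ⟨q 0, q 1⟩

theorem toComplex_ne_zero_iff {q : V} : toComplex q ≠ 0 ↔ rSq q ≠ 0 := by
  rw [Ne, Ne, rSq_eq_zero_iff, Complex.ext_iff]; rfl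

theorem toComplex_eq (q : V) : toComplex q = q 0 + q 1 * Complex.I := by
  apply Complex.ext <;> simp [toComplex]

theorem continuous_toComplex : Continuous toComplex := by
  rw [funext toComplex_eq]
  fun_prop

theorem hasDerivAt_toComplex {γ : ℝ → SymMat} {t : ℝ} (h : DifferentiableAt ℝ (chartCurve γ) t) :
    HasDerivAt (fun u => toComplex (chartCurve γ u)) (toComplex (velocity γ t)) t := by
  simp only [toComplex_eq]
  exact (hasDerivAt_chartCurve_apply h 0).ofReal_comp.add
    ((hasDerivAt_chartCurve_apply h 1).ofReal_comp.mul_const _)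

theorem im_toComplex_div (q v : V) : (toComplex v / toComplex q).im = dphi q v := by
  rw [Complex.div_im]
  simp only [toComplex, dphi, rSq, Complex.normSq_apply]
  ring

theorem hasDerivAt_im_log {γ : ℝ → SymMat} {t t₀ : ℝ}
    (h : DifferentiableAt ℝ (chartCurve γ) t) (h0 : toComplex (chartCurve γ t₀) ≠ 0)
    (hs : toComplex (chartCurve γ t) / toComplex (chartCurve γ t₀) ∈ Complex.slitPlane) :
    HasDerivAt (fun u => (Complex.log (toComplex (chartCurve γ u) / toComplex (chartCurve γ t₀))).im)
      (angularVelocity γ t) t := by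
  have h1 := ((hasDerivAt_toComplex h).div_const (toComplex (chartCurve γ t₀))).clog_real hs
  have h2 := Complex.imCLM.hasFDerivAt.comp_hasDerivAt t h1
  refine h2.congr_deriv ?_
  change Complex.im _ = _
  rw [div_div_div_cancel_right₀ h0, im_toComplex_div]
  rfl

namespace IsLoopAt

variable {p : SymMat} {γ : ℝ → SymMat}

/-- Away from the axis the swept angle is locally the argument. -/
theorem eventually_sweptAngle_eq (h : IsLoopAt p γ) (hp : p ∉ L) {t₀ : ℝ}
    (ht₀ : t₀ ∈ Icc (0 : ℝ) 1) (hL : γ t₀ ∉ L) : ∀ᶠ t in 𝓝[Icc 0 1] t₀,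
      toComplex (chartCurve γ t) / toComplex (chartCurve γ t₀) ∈ Complex.slitPlane ∧
      sweptAngle γ t = sweptAngle γ t₀ +
        (Complex.log (toComplex (chartCurve γ t) / toComplex (chartCurve γ t₀))).im := by
  obtain ⟨B, hBf, hB, -⟩ := h.exists_breakpoints
  have h0 : toComplex (chartCurve γ t₀) ≠ 0 := toComplex_ne_zero_iff.2 ((notMem_L_iff _).1 hL)
  have hwc : ContinuousOn (fun t => toComplex (chartCurve γ t) / toComplex (chartCurve γ t₀))
      (Icc 0 1) := (continuous_toComplex.comp_continuousOn h.continuousOn).div_const _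
  -- Dividing by the value at `t₀` brings the curve near `1`, where the principal logarithm is
  -- smooth.
  have hev : ∀ᶠ t in 𝓝[Icc 0 1] t₀,
      toComplex (chartCurve γ t) / toComplex (chartCurve γ t₀) ∈ Complex.slitPlane :=
    (hwc t₀ ht₀).eventually_mem (Complex.isOpen_slitPlane.mem_nhds (by simp [h0]))
  obtain ⟨ε, hε, hball⟩ := Metric.eventually_nhds_iff.1 (eventually_nhdsWithin_iff.1 hev)
  filter_upwards [nhdsWithin_le_nhds (Metric.ball_mem_nhds t₀ hε), self_mem_nhdsWithin] with t ht htI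
  have hsub : ∀ u ∈ uIcc t₀ t, u ∈ Icc (0 : ℝ) 1 ∧
      toComplex (chartCurve γ u) / toComplex (chartCurve γ t₀) ∈ Complex.slitPlane := by
    intro u hu
    have huI := uIcc_subset_Icc ht₀ htI hu
    refine ⟨huI, hball ?_ huI⟩
    rw [Metric.mem_ball, Real.dist_eq] at ht
    exact (Real.dist_eq u t₀).symm ▸ (abs_sub_left_of_mem_uIcc hu).trans_lt ht
  refine ⟨(hsub t right_mem_uIcc).2, ?_⟩
  have hint := integral_eq_of_hasDerivAt_off_countable
    (fun u => (Complex.log (toComplex (chartCurve γ u) / toComplex (chartCurve γ t₀))).im)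
    (angularVelocity γ) (a := t₀) (b := t) hBf.countable ?_ ?_ (h.intervalIntegrable hp ht₀ htI)
  · rw [div_self h0, Complex.log_one, Complex.zero_im, sub_zero] at hint
    rw [← hint]
    exact (intervalIntegral.integral_add_adjacent_intervals
      (h.intervalIntegrable hp (by simp) ht₀) (h.intervalIntegrable hp ht₀ htI)).symm
  · exact Complex.continuous_im.comp_continuousOn ((hwc.mono fun u hu => (hsub u hu).1).clog
      fun u hu => (hsub u hu).2)
  · rintro u ⟨hu, huB⟩
    have hu' := hsub u (Ioo_subset_Icc_self hu)
    exact hasDerivAt_im_log ((hB u hu'.1 huB).2.differentiableAt (by simp)) h0 hu'.2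

/-- Differentiability of the curve at `t` does not make its velocity continuous there, so the
derivative is taken from the local logarithm and not from the integral. -/
theorem hasDerivAt_sweptAngle (h : IsLoopAt p γ) (hp : p ∉ L) {t : ℝ} (ht : t ∈ Ioo (0 : ℝ) 1)
    (hL : γ t ∉ L) (hd : DifferentiableAt ℝ (chartCurve γ) t) :
    HasDerivAt (sweptAngle γ) (angularVelocity γ t) t := by
  have h0 : toComplex (chartCurve γ t) ≠ 0 := toComplex_ne_zero_iff.2 ((notMem_L_iff _).1 hL)
  have hev := h.eventually_sweptAngle_eq hp (Ioo_subset_Icc_self ht) hL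
  rw [nhdsWithin_eq_nhds.2 (Icc_mem_nhds ht.1 ht.2)] at hev
  exact ((hasDerivAt_im_log hd h0 (by simp [h0])).const_add _).congr_of_eventuallyEq
    (hev.mono fun u hu => hu.2)

end IsLoopAt

/-! ### Parallel transport in frame components -/

/-- The vector at `q` with components `a` in the reference frame. -/
def ofComponents (q : V) (a : Fin 3 → ℝ) : V :=
  a 0 • frame q 0 + a 1 • frame q 1 + a 2 • frame q 2

/-- Rotation of the first two components. -/
def rotate (θ : ℝ) (a : Fin 3 → ℝ) : Fin 3 → ℝ :=
  ![Real.cos θ * a 0 - Real.sin θ * a 1, Real.sin θ * a 0 + Real.cos θ * a 1, a 2]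

theorem rotation_apply (p : SymMat) (θ : ℝ) (v : V) :
    rotation p θ v = ofComponents (chart p) (rotate θ (frameComponents (chart p) v)) := rfl

theorem frameComponents_ofComponents {q : V} (hq : rSq q ≠ 0) (a : Fin 3 → ℝ) :
    frameComponents q (ofComponents q a) = a := frameComponents_frame hq a

theorem ofComponents_frameComponents {q : V} (hq : rSq q ≠ 0) (v : V) :
    ofComponents q (frameComponents q v) = v := frame_frameComponents hq v

theorem rotate_rotate (θ η : ℝ) (a : Fin 3 → ℝ) : rotate θ (rotate η a) = rotate (θ + η) a := by
  ext i
  fin_cases i <;> simp [rotate, Real.cos_add, Real.sin_add] <;> ring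

@[simp] theorem rotate_zero (a : Fin 3 → ℝ) : rotate 0 a = a := by
  ext i
  fin_cases i <;> simp [rotate]

theorem continuous_rotate : Continuous fun x : ℝ × (Fin 3 → ℝ) => rotate x.1 x.2 := by
  refine continuous_pi fun i => ?_
  fin_cases i <;> simp [rotate] <;> fun_prop

theorem ofComponents_eq (q : V) (a : Fin 3 → ℝ) : ofComponents q a =
    ![(a 0 * (q 0 ^ 2 / 2 + q 1 ^ 2) - a 1 * (q 0 * q 1 / 2)) / rSq q,
      (a 1 * (q 1 ^ 2 / 2 + q 0 ^ 2) - a 0 * (q 0 * q 1 / 2)) / rSq q, a 2] := by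
  ext i
  fin_cases i <;> simp [ofComponents, frame] <;> ring

theorem continuousAt_ofComponents {q : V} (hq : rSq q ≠ 0) (a : Fin 3 → ℝ) :
    ContinuousAt (fun x : V × (Fin 3 → ℝ) => ofComponents x.1 x.2) (q, a) := by
  simp only [ofComponents_eq]
  have hr : ContinuousAt (fun x : V × (Fin 3 → ℝ) => rSq x.1) (q, a) :=
    (continuous_rSq.comp continuous_fst).continuousAt
  refine continuousAt_pi.2 fun i => ?_
  fin_cases i
  · exact ContinuousAt.div (by fun_prop) hr hq
  · exact ContinuousAt.div (by fun_prop) hr hq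
  · exact Continuous.continuousAt (by simp; fun_prop)

theorem continuousAt_frameComponents {q : V} (hq : rSq q ≠ 0) (v : V) :
    ContinuousAt (fun x : V × V => frameComponents x.1 x.2) (q, v) := by
  have hr : ContinuousAt (fun x : V × V => rSq x.1) (q, v) :=
    (continuous_rSq.comp continuous_fst).continuousAt
  have he : (fun x : V × V => frameComponents x.1 x.2) =ᶠ[𝓝 (q, v)] fun x =>
      ![((2 * x.1 0 ^ 2 + x.1 1 ^ 2) * x.2 0 + x.1 0 * x.1 1 * x.2 1) / rSq x.1,
      (x.1 0 * x.1 1 * x.2 0 + (x.1 0 ^ 2 + 2 * x.1 1 ^ 2) * x.2 1) / rSq x.1, x.2 2] := by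
    filter_upwards [hr.eventually_ne hq] with x hx
    exact frameComponents_eq hx x.2
  refine ContinuousAt.congr ?_ he.symm
  refine continuousAt_pi.2 fun i => ?_
  fin_cases i
  · exact ContinuousAt.div (by fun_prop) hr hq
  · exact ContinuousAt.div (by fun_prop) hr hq
  · exact Continuous.continuousAt (by simp; fun_prop)

theorem rSq_chartCurve_ne_zero {γ : ℝ → SymMat} {t : ℝ} (hL : γ t ∉ L) :
    rSq (chartCurve γ t) ≠ 0 := (notMem_L_iff _).1 hL

theorem continuousWithinAt_ofComponents {q : ℝ → V} {a : ℝ → Fin 3 → ℝ} {s : Set ℝ} {t : ℝ}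
    (hr : rSq (q t) ≠ 0) (hq : ContinuousWithinAt q s t) (ha : ContinuousWithinAt a s t) :
    ContinuousWithinAt (fun u => ofComponents (q u) (a u)) s t :=
  ContinuousAt.comp_continuousWithinAt (f := fun u => (q u, a u))
    (continuousAt_ofComponents hr (a t)) (hq.prodMk ha)

theorem continuousWithinAt_frameComponents {q v : ℝ → V} {s : Set ℝ} {t : ℝ}
    (hr : rSq (q t) ≠ 0) (hq : ContinuousWithinAt q s t) (hv : ContinuousWithinAt v s t) :
    ContinuousWithinAt (fun u => frameComponents (q u) (v u)) s t :=
  ContinuousAt.comp_continuousWithinAt (f := fun u => (q u, v u))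
    (continuousAt_frameComponents hr (v t)) (hq.prodMk hv)

theorem continuousWithinAt_rotate {θ : ℝ → ℝ} {a : ℝ → Fin 3 → ℝ} {s : Set ℝ} {t : ℝ}
    (hθ : ContinuousWithinAt θ s t) (ha : ContinuousWithinAt a s t) :
    ContinuousWithinAt (fun u => rotate (θ u) (a u)) s t :=
  ContinuousAt.comp_continuousWithinAt (f := fun u => (θ u, a u))
    continuous_rotate.continuousAt (hθ.prodMk ha)

theorem hasDerivAt_rSq {γ : ℝ → SymMat} {t : ℝ} (hd : DifferentiableAt ℝ (chartCurve γ) t) :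
    HasDerivAt (fun u => rSq (chartCurve γ u))
      (2 * chartCurve γ t 0 * velocity γ t 0 + 2 * chartCurve γ t 1 * velocity γ t 1) t := by
  exact (((hasDerivAt_chartCurve_apply hd 0).pow 2).add
    ((hasDerivAt_chartCurve_apply hd 1).pow 2)).congr_deriv (by simp)

/-- The frame is rotated by half the angular velocity under the Levi-Civita connection: a field
whose components rotate the other way is parallel. -/
theorem hasDerivAt_ofComponents {γ : ℝ → SymMat} {t : ℝ} (hL : γ t ∉ L)
    (hd : DifferentiableAt ℝ (chartCurve γ) t) {a : ℝ → Fin 3 → ℝ}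
    (ha : HasDerivAt a
      ![-(angularVelocity γ t / 2 * a t 1), angularVelocity γ t / 2 * a t 0, 0] t) :
    HasDerivAt (fun u => ofComponents (chartCurve γ u) (a u))
      (fun k => -∑ i, ∑ j, christoffel k i j (chartCurve γ t) * velocity γ t i *
        ofComponents (chartCurve γ t) (a t) j) t := by
  have hr := rSq_chartCurve_ne_zero hL
  have hx := hasDerivAt_chartCurve_apply hd 0
  have hy := hasDerivAt_chartCurve_apply hd 1
  have ha0 := hasDerivAt_pi.1 ha 0
  have ha1 := hasDerivAt_pi.1 ha 1
  have ha2 := hasDerivAt_pi.1 ha 2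
  have hR := hasDerivAt_rSq hd
  simp only [sum_christoffel hr]
  simp only [ofComponents_eq, angularVelocity] at *
  refine hasDerivAt_pi.2 fun k => ?_
  fin_cases k
  · refine (((ha0.mul (((hx.pow 2).div_const 2).add (hy.pow 2))).sub
      (ha1.mul ((hx.mul hy).div_const 2))).div hR hr).congr_deriv ?_
    simp [horiz, dphi]
    unfold rSq at *
    field_simp
    ring
  · refine (((ha1.mul (((hy.pow 2).div_const 2).add (hx.pow 2))).sub
      (ha0.mul ((hx.mul hy).div_const 2))).div hR hr).congr_deriv ?_
    simp [horiz, dphi]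
    unfold rSq at *
    field_simp
    ring
  · refine ha2.congr_deriv ?_
    simp [horiz]

/-- The frame components of a parallel field rotate with half the angular velocity. -/
theorem hasDerivAt_frameComponents {γ : ℝ → SymMat} {t : ℝ} (hL : γ t ∉ L)
    (hd : DifferentiableAt ℝ (chartCurve γ) t) {E : ℝ → V}
    (hE : HasDerivAt E
      (fun k => -∑ i, ∑ j, christoffel k i j (chartCurve γ t) * velocity γ t i * E t j) t) :
    HasDerivAt (fun u => frameComponents (chartCurve γ u) (E u))
      ![-(angularVelocity γ t / 2 * frameComponents (chartCurve γ t) (E t) 1),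
        angularVelocity γ t / 2 * frameComponents (chartCurve γ t) (E t) 0, 0] t := by
  have hr := rSq_chartCurve_ne_zero hL
  have hx := hasDerivAt_chartCurve_apply hd 0
  have hy := hasDerivAt_chartCurve_apply hd 1
  simp only [sum_christoffel hr] at hE
  have hE0 := hasDerivAt_pi.1 hE 0
  have hE1 := hasDerivAt_pi.1 hE 1
  have hE2 := hasDerivAt_pi.1 hE 2
  have hR := hasDerivAt_rSq hd
  have he : (fun u => frameComponents (chartCurve γ u) (E u)) =ᶠ[𝓝 t] fun u =>
      ![((2 * chartCurve γ u 0 ^ 2 + chartCurve γ u 1 ^ 2) * E u 0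
          + chartCurve γ u 0 * chartCurve γ u 1 * E u 1) / rSq (chartCurve γ u),
        (chartCurve γ u 0 * chartCurve γ u 1 * E u 0
          + (chartCurve γ u 0 ^ 2 + 2 * chartCurve γ u 1 ^ 2) * E u 1) / rSq (chartCurve γ u),
        E u 2] := by
    filter_upwards [hR.continuousAt.eventually_ne hr] with u hu
    exact frameComponents_eq hu (E u)
  refine HasDerivAt.congr_of_eventuallyEq ?_ he
  rw [frameComponents_eq hr]
  refine hasDerivAt_pi.2 fun k => ?_
  fin_cases k
  · refine ((((((hx.pow 2).const_mul 2).add (hy.pow 2)).mul hE0).add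
      ((hx.mul hy).mul hE1)).div hR hr).congr_deriv ?_
    simp [horiz, dphi, angularVelocity]
    unfold rSq at *
    field_simp
    ring
  · refine ((((hx.mul hy).mul hE0).add
      (((hx.pow 2).add ((hy.pow 2).const_mul 2)).mul hE1)).div hR hr).congr_deriv ?_
    simp [horiz, dphi, angularVelocity]
    unfold rSq at *
    field_simp
    ring
  · refine hE2.congr_deriv ?_
    simp [horiz]

/-- Differentiating the angle inserts a quarter turn of `e₁, e₂`, which commutes with the rotation
and so can be moved inside it. -/
theorem hasDerivAt_rotate {θ : ℝ → ℝ} {a : ℝ → Fin 3 → ℝ} {θ' t : ℝ} {a' : Fin 3 → ℝ}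
    (hθ : HasDerivAt θ θ' t) (ha : HasDerivAt a a' t) :
    HasDerivAt (fun u => rotate (θ u) (a u)) (rotate (θ t) (a' + ![-(θ' * a t 1), θ' * a t 0, 0]))
      t := by
  have h (i : Fin 3) := hasDerivAt_pi.1 ha i
  refine hasDerivAt_pi.2 fun k => ?_
  fin_cases k
  · refine ((hθ.cos.mul (h 0)).sub (hθ.sin.mul (h 1))).congr_deriv ?_
    simp [rotate]
    ring
  · refine ((hθ.sin.mul (h 0)).add (hθ.cos.mul (h 1))).congr_deriv ?_
    simp [rotate]
    ring
  · refine (h 2).congr_deriv ?_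
    simp [rotate]

namespace IsLoopAt

variable {p : SymMat} {γ : ℝ → SymMat}

/-- Existence of transport: rotation by half the swept angle solves the component equation, and
continuity of that angle across `L` supplies the limits at crossings. -/
theorem isParallelAlong_rotate (h : IsLoopAt p γ) (hp : p ∉ L) (a : Fin 3 → ℝ) :
    IsParallelAlong γ fun t => ofComponents (chartCurve γ t) (rotate (sweptAngle γ t / 2) a) := by
  have hrot : ContinuousOn (fun t => rotate (sweptAngle γ t / 2) a) (Icc 0 1) :=
    fun t ht => continuousWithinAt_rotate (((h.continuousOn_sweptAngle hp).div_const 2) t ht)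
      continuousWithinAt_const
  refine ⟨fun t ht hL => ?_, fun t ht hL hd => ?_, fun t ht hL => ?_⟩
  · exact continuousWithinAt_ofComponents (rSq_chartCurve_ne_zero hL) (h.continuousOn t ht)
      (hrot t ht)
  · refine hasDerivAt_ofComponents hL hd (a := fun t => rotate (sweptAngle γ t / 2) a) ?_
    refine (hasDerivAt_rotate ((h.hasDerivAt_sweptAngle hp ht hL hd).div_const 2)
      (hasDerivAt_const t a)).congr_deriv ?_
    ext i
    fin_cases i <;> simp [rotate] <;> ring
  · refine ⟨rotate (sweptAngle γ t / 2) a, ?_⟩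
    have hc : Tendsto (fun t => rotate (sweptAngle γ t / 2) a) (𝓝[≠] t)
        (𝓝 (rotate (sweptAngle γ t / 2) a)) :=
      (hrot.continuousAt (Icc_mem_nhds ht.1 ht.2)).tendsto.mono_left nhdsWithin_le_nhds
    refine hc.congr' ?_
    filter_upwards [h.eventually_notMem_L_of_mem ht hL] with u hu
    exact (frameComponents_ofComponents (rSq_chartCurve_ne_zero hu) _).symm

theorem chartCurve_zero (h : IsLoopAt p γ) : chartCurve γ 0 = chart p := congrArg chart h.source

theorem chartCurve_one (h : IsLoopAt p γ) : chartCurve γ 1 = chart p := congrArg chart h.target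

theorem sweptAngle_zero (γ : ℝ → SymMat) : sweptAngle γ 0 = 0 := intervalIntegral.integral_same

/-- A parallel field is determined by its initial value. -/
theorem apply_one_of_isParallelAlong (h : IsLoopAt p γ) (hp : p ∉ L) {E : ℝ → V}
    (hE : IsParallelAlong γ E) : E 1 = rotation p (sweptAngle γ 1 / 2) (E 0) := by
  have hcΦ : ContinuousOn (fun t => -(sweptAngle γ t / 2)) (Icc 0 1) :=
    ((h.continuousOn_sweptAngle hp).div_const 2).neg
  -- Turning the components back by half the swept angle cancels their rotation, so the result has
  -- zero derivative off `L`.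
  have key := h.eq_of_hasDerivAt_zero hp
    (fun t => rotate (-(sweptAngle γ t / 2)) (frameComponents (chartCurve γ t) (E t))) ?_ ?_ ?_
  · simp only [sweptAngle_zero, zero_div, neg_zero, rotate_zero, h.chartCurve_zero,
      h.chartCurve_one] at key
    have hr := (notMem_L_iff _).1 hp
    rw [rotation_apply, ← key, rotate_rotate, add_neg_cancel, rotate_zero,
      ofComponents_frameComponents hr]
  · intro t ht hL
    exact continuousWithinAt_rotate (hcΦ t ht) (continuousWithinAt_frameComponents
      (rSq_chartCurve_ne_zero hL) (h.continuousOn t ht) (hE.continuous t ht hL))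
  · intro t ht hL
    obtain ⟨c, hc⟩ := hE.crossing t ht hL
    have hΦ : Tendsto (fun t => -(sweptAngle γ t / 2)) (𝓝[≠] t) (𝓝 (-(sweptAngle γ t / 2))) :=
      (hcΦ.continuousAt (Icc_mem_nhds ht.1 ht.2)).tendsto.mono_left nhdsWithin_le_nhds
    exact ⟨rotate (-(sweptAngle γ t / 2)) c, Tendsto.comp
      (g := fun x : ℝ × (Fin 3 → ℝ) => rotate x.1 x.2)
      (f := fun u => (-(sweptAngle γ u / 2), frameComponents (chartCurve γ u) (E u)))
      (continuous_rotate.tendsto (-(sweptAngle γ t / 2), c)) (hΦ.prodMk_nhds hc)⟩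
  · intro t ht hL hd
    refine (hasDerivAt_rotate ((h.hasDerivAt_sweptAngle hp ht hL hd).div_const 2).neg
      (hasDerivAt_frameComponents hL hd (hE.parallel t ht hL hd))).congr_deriv ?_
    ext i
    fin_cases i <;> simp [rotate]

theorem pi_mul_windingNumber (γ : ℝ → SymMat) :
    Real.pi * windingNumber γ = sweptAngle γ 1 / 2 := by
  have := Real.pi_ne_zero
  unfold windingNumber sweptAngle angularVelocity
  field_simp

theorem isParallelTransport_iff (h : IsLoopAt p γ) (hp : p ∉ L) (T : V →ₗ[ℝ] V) :
    IsParallelTransport γ T ↔ T = rotation p (sweptAngle γ 1 / 2) := by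
  constructor
  · intro hT
    refine LinearMap.ext fun v => ?_
    obtain ⟨E, hE, h0, h1⟩ := hT v
    rw [← h1, ← h0]
    exact h.apply_one_of_isParallelAlong hp hE
  · rintro rfl v
    refine ⟨_, h.isParallelAlong_rotate hp (frameComponents (chart p) v), ?_, ?_⟩
    · simp only [sweptAngle_zero, zero_div, rotate_zero, h.chartCurve_zero]
      exact ofComponents_frameComponents ((notMem_L_iff _).1 hp) v
    · simp only [h.chartCurve_one, rotation_apply]

/-! ### Quantization of the swept angle -/

/-- The direction of the horizontal part, turned back by the swept angle. -/
def _root_.SymHol.unwound (γ : ℝ → SymMat) (t : ℝ) : ℂ :=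
  toComplex (chartCurve γ t) / ‖toComplex (chartCurve γ t)‖ *
    Complex.exp (-(sweptAngle γ t * Complex.I))

/-- Locally the swept angle grows by the argument of the quotient `z` of positions, and `exp (-i arg
z)` cancels the factor `z / ‖z‖` in the direction. -/
theorem eventually_unwound_eq (h : IsLoopAt p γ) (hp : p ∉ L) {t₀ : ℝ}
    (ht₀ : t₀ ∈ Icc (0 : ℝ) 1) (hL : γ t₀ ∉ L) :
    ∀ᶠ t in 𝓝[Icc 0 1] t₀, unwound γ t = unwound γ t₀ := by
  have h0 : toComplex (chartCurve γ t₀) ≠ 0 := toComplex_ne_zero_iff.2 ((notMem_L_iff _).1 hL)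
  filter_upwards [h.eventually_sweptAngle_eq hp ht₀ hL] with t ⟨hs, ht⟩
  have hz := Complex.slitPlane_ne_zero hs
  unfold unwound
  rw [ht, Complex.log_im]
  set z := toComplex (chartCurve γ t) / toComplex (chartCurve γ t₀)
  have hw : toComplex (chartCurve γ t) = toComplex (chartCurve γ t₀) * z :=
    (mul_div_cancel₀ _ h0).symm
  have hz' : (‖z‖ : ℂ) ≠ 0 := by simpa using hz
  have h0' : (‖toComplex (chartCurve γ t₀)‖ : ℂ) ≠ 0 := by simpa using h0
  have hpol := Complex.norm_mul_exp_arg_mul_I z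
  rw [hw, norm_mul, Complex.ofReal_add, add_mul, neg_add, Complex.exp_add, Complex.ofReal_mul]
  nth_rewrite 1 [← hpol]
  rw [Complex.exp_neg (Complex.arg z * Complex.I)]
  have := Complex.exp_ne_zero (Complex.arg z * Complex.I)
  field_simp

theorem hasDerivAt_unwound (h : IsLoopAt p γ) (hp : p ∉ L) {t : ℝ} (ht : t ∈ Ioo (0 : ℝ) 1)
    (hL : γ t ∉ L) : HasDerivAt (unwound γ) 0 t := by
  have := h.eventually_unwound_eq hp (Ioo_subset_Icc_self ht) hL
  rw [nhdsWithin_eq_nhds.2 (Icc_mem_nhds ht.1 ht.2)] at this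
  exact (hasDerivAt_const t (unwound γ t)).congr_of_eventuallyEq this

theorem continuousWithinAt_unwound (h : IsLoopAt p γ) (hp : p ∉ L) {t : ℝ}
    (ht : t ∈ Icc (0 : ℝ) 1) (hL : γ t ∉ L) : ContinuousWithinAt (unwound γ) (Icc 0 1) t :=
  continuousWithinAt_const.congr_of_eventuallyEq (h.eventually_unwound_eq hp ht hL) rfl

theorem unwound_one (h : IsLoopAt p γ) :
    unwound γ 1 = unwound γ 0 * Complex.exp (-(sweptAngle γ 1 * Complex.I)) := by
  simp [unwound, h.chartCurve_one, h.chartCurve_zero, sweptAngle_zero]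

theorem unwound_zero_ne_zero (h : IsLoopAt p γ) (hp : p ∉ L) : unwound γ 0 ≠ 0 := by
  have h0 : toComplex (chart p) ≠ 0 := toComplex_ne_zero_iff.2 ((notMem_L_iff _).1 hp)
  simp [unwound, h.chartCurve_zero, h0]

/-- Without crossings `unwound` has equal end values. The loop closes, so `exp (-iΦ) = 1` for the
total angle `Φ`. -/
theorem sweptAngle_of_avoids (h : IsLoopAt p γ) (hp : p ∉ L)
    (hU : ∀ t ∈ Icc (0 : ℝ) 1, γ t ∉ L) : ∃ k : ℤ, sweptAngle γ 1 / 2 = k * Real.pi := by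
  have key := h.eq_of_hasDerivAt_zero hp (unwound γ)
    (fun t ht hL => h.continuousWithinAt_unwound hp ht hL)
    (fun t ht hL => absurd hL (hU t (Ioo_subset_Icc_self ht)))
    (fun t ht hL _ => h.hasDerivAt_unwound hp ht hL)
  rw [h.unwound_one, mul_eq_left₀ (h.unwound_zero_ne_zero hp), Complex.exp_eq_one_iff] at key
  obtain ⟨n, hn⟩ := key
  refine ⟨-n, ?_⟩
  have := congrArg Complex.im hn
  simp at this
  push_cast
  linarith

/-- With velocity `v` at the crossing, the unit direction tends to `v / ‖v‖` from one side and `-v /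
‖v‖` from the other; squaring removes the sign. -/
theorem tendsto_unwound_sq (h : IsLoopAt p γ) (hp : p ∉ L) {t : ℝ} (ht : t ∈ Ioo (0 : ℝ) 1)
    (hL : γ t ∈ L) : ∃ l, Tendsto (fun u => unwound γ u ^ 2) (𝓝[≠] t) (𝓝 l) := by
  have hd := (h.contDiffAt_of_mem_L ht hL).differentiableAt (by simp)
  have hw := hasDerivAt_iff_tendsto_slope.1 (hasDerivAt_toComplex hd)
  have hw0 : toComplex (chartCurve γ t) = 0 := by
    by_contra hne
    exact (notMem_L_iff _).2 (toComplex_ne_zero_iff.1 hne) hL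
  have hv : toComplex (velocity γ t) ≠ 0 := by
    rw [toComplex_ne_zero_iff, Ne, rSq_eq_zero_iff]
    have := h.transverse t ht hL
    tauto
  have hΦ : Tendsto (fun u => Complex.exp (-(sweptAngle γ u * Complex.I))) (𝓝[≠] t)
      (𝓝 (Complex.exp (-(sweptAngle γ t * Complex.I)))) := by
    have hc : ContinuousAt (sweptAngle γ) t :=
      (h.continuousOn_sweptAngle hp).continuousAt (Icc_mem_nhds ht.1 ht.2)
    have hc' : ContinuousAt (fun u => Complex.exp (-(sweptAngle γ u * Complex.I))) t := by fun_prop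
    exact hc'.tendsto.mono_left nhdsWithin_le_nhds
  have hn : Tendsto (fun u => ((‖slope (fun u => toComplex (chartCurve γ u)) t u‖ : ℝ) : ℂ))
      (𝓝[≠] t) (𝓝 ‖toComplex (velocity γ t)‖) :=
    (Complex.continuous_ofReal.tendsto _).comp hw.norm
  -- The slope tends to `v`. Replacing position by slope alters the unit direction only by the sign
  -- of `u - t`, which disappears because `|u - t|² = (u - t)²`.
  refine ⟨_, (((hw.div hn (by simpa using hv)).mul hΦ).pow 2).congr' ?_⟩
  filter_upwards [self_mem_nhdsWithin] with u hu
  have hut : u - t ≠ 0 := sub_ne_zero.2 hu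
  have hutc : (u : ℂ) - t ≠ 0 := by exact_mod_cast hut
  have hsq : (((|u - t| : ℝ) : ℂ)) ^ 2 = ((u : ℂ) - t) ^ 2 := by
    rw [← Complex.ofReal_pow, sq_abs]; push_cast; rfl
  simp only [Pi.div_apply, slope, vsub_eq_sub, hw0, sub_zero, unwound, norm_smul, norm_inv, Real.norm_eq_abs]
  rw [Complex.real_smul]
  push_cast
  simp only [div_pow, mul_pow, inv_pow, hsq]
  rw [mul_div_mul_left _ _ (inv_ne_zero (pow_ne_zero 2 hutc))]

/-- Only the square passes through crossings, so the conclusion is `exp (-2iΦ) = 1` for the total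
angle `Φ`. -/
theorem exists_sweptAngle_eq (h : IsLoopAt p γ) (hp : p ∉ L) :
    ∃ k : ℤ, sweptAngle γ 1 / 2 = k * (Real.pi / 2) := by
  have key := h.eq_of_hasDerivAt_zero hp (fun t => unwound γ t ^ 2)
    (fun t ht hL => (h.continuousWithinAt_unwound hp ht hL).pow 2)
    (fun t ht hL => h.tendsto_unwound_sq hp ht hL)
    (fun t ht hL _ => ((h.hasDerivAt_unwound hp ht hL).pow 2).congr_deriv (by simp))
  simp only [h.unwound_one, mul_pow] at key
  rw [mul_eq_left₀ (pow_ne_zero 2 (h.unwound_zero_ne_zero hp)), ← Complex.exp_nat_mul,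
    Complex.exp_eq_one_iff] at key
  obtain ⟨n, hn⟩ := key
  refine ⟨-n, ?_⟩
  have := congrArg Complex.im hn
  simp at this
  push_cast
  linarith

end IsLoopAt

/-! ### Spirals realizing all angles -/

/-- The curve which turns around the axis from `p` with constant angular velocity `a`, at a distance
from the axis scaled by `ρ`. -/
def spiral (p : SymMat) (a : ℝ) (ρ : ℝ → ℝ) (t : ℝ) : SymMat :=
  chart.symm ![ρ t * (Real.cos (a * t) * chart p 0 - Real.sin (a * t) * chart p 1),
    ρ t * (Real.sin (a * t) * chart p 0 + Real.cos (a * t) * chart p 1), chart p 2]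

theorem chartCurve_spiral (p : SymMat) (a : ℝ) (ρ : ℝ → ℝ) (t : ℝ) :
    chartCurve (spiral p a ρ) t =
      ![ρ t * (Real.cos (a * t) * chart p 0 - Real.sin (a * t) * chart p 1),
        ρ t * (Real.sin (a * t) * chart p 0 + Real.cos (a * t) * chart p 1), chart p 2] :=
  chart.apply_symm_apply _

theorem rSq_spiral (p : SymMat) (a : ℝ) (ρ : ℝ → ℝ) (t : ℝ) :
    rSq (chartCurve (spiral p a ρ) t) = ρ t ^ 2 * rSq (chart p) := by
  have := Real.sin_sq_add_cos_sq (a * t)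
  rw [chartCurve_spiral]
  simp only [rSq, Matrix.cons_val_zero, Matrix.cons_val_one]
  linear_combination (ρ t ^ 2 * (chart p 0 ^ 2 + chart p 1 ^ 2)) * this

theorem spiral_mem_L_iff {p : SymMat} (hp : p ∉ L) (a : ℝ) (ρ : ℝ → ℝ) (t : ℝ) :
    spiral p a ρ t ∈ L ↔ ρ t = 0 := by
  rw [mem_L_iff]
  change rSq (chartCurve (spiral p a ρ) t) = 0 ↔ _
  rw [rSq_spiral, mul_eq_zero, or_iff_left ((notMem_L_iff _).1 hp)]
  exact pow_eq_zero_iff two_ne_zero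

theorem hasDerivAt_spiral (p : SymMat) (a : ℝ) {ρ : ℝ → ℝ} {ρ' t : ℝ} (hρ : HasDerivAt ρ ρ' t) :
    HasDerivAt (chartCurve (spiral p a ρ))
      ![ρ' * (Real.cos (a * t) * chart p 0 - Real.sin (a * t) * chart p 1)
          - a * (ρ t * (Real.sin (a * t) * chart p 0 + Real.cos (a * t) * chart p 1)),
        ρ' * (Real.sin (a * t) * chart p 0 + Real.cos (a * t) * chart p 1)
          + a * (ρ t * (Real.cos (a * t) * chart p 0 - Real.sin (a * t) * chart p 1)), 0] t := by
  have ha : HasDerivAt (fun u => a * u) a t := by simpa using (hasDerivAt_id t).const_mul a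
  rw [funext (chartCurve_spiral p a ρ)]
  refine hasDerivAt_pi.2 fun i => ?_
  fin_cases i
  · refine (hρ.mul ((ha.cos.mul_const (chart p 0)).sub
      (ha.sin.mul_const (chart p 1)))).congr_deriv ?_
    simp
    ring
  · refine (hρ.mul ((ha.sin.mul_const (chart p 0)).add
      (ha.cos.mul_const (chart p 1)))).congr_deriv ?_
    simp
    ring
  · exact hasDerivAt_const t (chart p 2)

theorem contDiff_spiral (p : SymMat) (a : ℝ) {ρ : ℝ → ℝ} (hρ : ContDiff ℝ ∞ ρ) :
    ContDiff ℝ ∞ (chartCurve (spiral p a ρ)) := by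
  rw [funext (chartCurve_spiral p a ρ)]
  refine contDiff_pi.2 fun i => ?_
  fin_cases i <;> simp <;> fun_prop

theorem angularVelocity_spiral {p : SymMat} (hp : p ∉ L) (a : ℝ) {ρ : ℝ → ℝ} {t : ℝ}
    (hρ : DifferentiableAt ℝ ρ t) (h0 : ρ t ≠ 0) : angularVelocity (spiral p a ρ) t = a := by
  have hr := (notMem_L_iff _).1 hp
  have := Real.sin_sq_add_cos_sq (a * t)
  unfold angularVelocity dphi velocity
  rw [(hasDerivAt_spiral p a hρ.hasDerivAt).deriv, rSq_spiral,
    div_eq_iff (mul_ne_zero (pow_ne_zero 2 h0) hr), chartCurve_spiral]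
  simp only [rSq, Matrix.cons_val_zero, Matrix.cons_val_one]
  linear_combination (a * ρ t ^ 2 * (chart p 0 ^ 2 + chart p 1 ^ 2)) * this

/-- The end conditions make `a` a multiple of `π` and `ρ 1 = cos a = ±1`, so a half turn is closed
up by a sign change of `ρ`. At a zero of `ρ` the horizontal velocity is `ρ'` times the rotated
horizontal part of `p`, hence nonzero if the zero is simple. -/
theorem isLoopAt_spiral {p : SymMat} (hp : p ∉ L) (a : ℝ) {ρ : ℝ → ℝ} (hρ : ContDiff ℝ ∞ ρ)
    (h0 : ρ 0 = 1) (hc : ρ 1 * Real.cos a = 1) (hs : Real.sin a = 0)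
    (ht : ∀ t, ρ t = 0 → deriv ρ t ≠ 0) : IsLoopAt p (spiral p a ρ) := by
  have hsrc : spiral p a ρ 0 = p := by
    apply chart.injective
    change chartCurve (spiral p a ρ) 0 = _
    rw [chartCurve_spiral]
    ext i
    fin_cases i <;> simp [h0]
  have htgt : spiral p a ρ 1 = p := by
    apply chart.injective
    change chartCurve (spiral p a ρ) 1 = _
    rw [chartCurve_spiral]
    ext i
    fin_cases i <;> simp [hs, ← mul_assoc, hc]
  refine ⟨hsrc, htgt, ⟨1, fun i => i, Nat.mono_cast, by simp, by simp,
    fun i _ => (contDiff_spiral p a hρ).contDiffOn, fun i hi => ?_⟩, fun t _ hL => ?_⟩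
  · interval_cases i
    · simpa [hsrc] using hp
    · simpa [htgt] using hp
  · have hz := (spiral_mem_L_iff hp a ρ t).1 hL
    have hd := ht t hz
    have hr := (notMem_L_iff _).1 hp
    have hsc := Real.sin_sq_add_cos_sq (a * t)
    by_contra! hv
    unfold velocity at hv
    rw [(hasDerivAt_spiral p a (hρ.differentiable (by simp) t).hasDerivAt).deriv] at hv
    simp only [hz, zero_mul, mul_zero, sub_zero, add_zero, Matrix.cons_val_zero,
      Matrix.cons_val_one, mul_eq_zero, hd, false_or] at hv
    apply hr
    unfold rSq
    linear_combination (Real.cos (a * t) * chart p 0 - Real.sin (a * t) * chart p 1) * hv.1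
      + (Real.sin (a * t) * chart p 0 + Real.cos (a * t) * chart p 1) * hv.2
      - (chart p 0 ^ 2 + chart p 1 ^ 2) * hsc

/-- The angular velocity is `a` except at the finitely many crossings, which have measure zero; the
half-turn jump of `φ` there is not counted. -/
theorem sweptAngle_spiral {p : SymMat} (hp : p ∉ L) (a : ℝ) {ρ : ℝ → ℝ} (hρ : ContDiff ℝ ∞ ρ)
    (h : IsLoopAt p (spiral p a ρ)) : sweptAngle (spiral p a ρ) 1 = a := by
  have hf := h.finite_crossings hp
  have : sweptAngle (spiral p a ρ) 1 = ∫ _ in (0 : ℝ)..1, a := by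
    refine intervalIntegral.integral_congr_ae ?_
    filter_upwards [compl_mem_ae_iff.2 (hf.measure_zero volume)] with t ht htI
    rw [uIoc_of_le zero_le_one] at htI
    refine angularVelocity_spiral hp a (hρ.differentiable (by simp) t) fun hz => ht ?_
    exact ⟨Ioc_subset_Icc_self htI, (spiral_mem_L_iff hp a ρ t).2 hz⟩
  simpa using this

/-- Loops around the axis. -/
theorem exists_loop_avoiding {p : SymMat} (hp : p ∉ L) (k : ℤ) :
    ∃ γ, IsLoopAt p γ ∧ (∀ t ∈ Icc (0 : ℝ) 1, γ t ∉ L) ∧ sweptAngle γ 1 / 2 = k * Real.pi := by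
  have h := isLoopAt_spiral hp (k * (2 * Real.pi)) (ρ := fun _ => 1) contDiff_const rfl
    (by simp [Real.cos_int_mul_two_pi]) (by
      have := Real.sin_int_mul_pi (k * 2)
      push_cast at this
      rwa [mul_assoc] at this) (by simp)
  refine ⟨_, h, fun t _ hL => one_ne_zero ((spiral_mem_L_iff hp _ _ t).1 hL), ?_⟩
  rw [sweptAngle_spiral hp _ contDiff_const h]
  ring

/-- Loops through the axis. -/
theorem exists_loop {p : SymMat} (hp : p ∉ L) (k : ℤ) :
    ∃ γ, IsLoopAt p γ ∧ sweptAngle γ 1 / 2 = k * (Real.pi / 2) := by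
  -- With this `ρ` and angle `kπ`, the end scale `cos kπ = (-1)^k` matches the sign of the rotation,
  -- and all zeros are simple.
  have hρ : ContDiff ℝ ∞ fun t : ℝ => Real.cos (k * Real.pi * t) := by fun_prop
  have hd (t : ℝ) : HasDerivAt (fun t : ℝ => Real.cos (k * Real.pi * t))
      (-Real.sin (k * Real.pi * t) * (k * Real.pi)) t := by
    simpa using ((hasDerivAt_id t).const_mul (k * Real.pi)).cos
  have hsin := Real.sin_int_mul_pi k
  have h := isLoopAt_spiral hp (k * Real.pi) hρ (by simp)
    (by have := Real.sin_sq_add_cos_sq (k * Real.pi); rw [hsin] at this; simp only [mul_one]; linarith)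
    hsin (fun t ht => by
      rw [(hd t).deriv]
      have hsc := Real.sin_sq_add_cos_sq (k * Real.pi * t)
      rw [ht] at hsc
      have hk : (k : ℝ) ≠ 0 := fun hk => by simp [hk] at ht
      refine mul_ne_zero (neg_ne_zero.2 fun hs => ?_) (mul_ne_zero hk Real.pi_ne_zero)
      rw [hs] at hsc
      norm_num at hsc)
  refine ⟨_, h, ?_⟩
  rw [sweptAngle_spiral hp _ hρ h]
  ring

/-! ### The group of rotations and the holonomy groups -/

theorem frameComponents_rotation {p : SymMat} (hp : p ∉ L) (θ : ℝ) (v : V) :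
    frameComponents (chart p) (rotation p θ v) = rotate θ (frameComponents (chart p) v) := by
  rw [rotation_apply, frameComponents_ofComponents ((notMem_L_iff p).1 hp)]

theorem rotation_comp {p : SymMat} (hp : p ∉ L) (θ η : ℝ) :
    rotation p θ ∘ₗ rotation p η = rotation p (θ + η) := by
  refine LinearMap.ext fun v => ?_
  rw [LinearMap.comp_apply, rotation_apply, frameComponents_rotation hp, rotate_rotate,
    ← rotation_apply]

theorem rotation_zero {p : SymMat} (hp : p ∉ L) : rotation p 0 = LinearMap.id := by
  refine LinearMap.ext fun v => ?_
  rw [rotation_apply, rotate_zero]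
  exact ofComponents_frameComponents ((notMem_L_iff _).1 hp) v

/-- The rotations, as a one-parameter group. -/
def rotationHom {p : SymMat} (hp : p ∉ L) : Multiplicative ℝ →* (V ≃ₗ[ℝ] V) where
  toFun θ := LinearEquiv.ofLinearMap (rotation p θ.toAdd) (rotation p (-θ.toAdd))
    (by rw [rotation_comp hp, add_neg_cancel, rotation_zero hp])
    (by rw [rotation_comp hp, neg_add_cancel, rotation_zero hp])
  map_one' := LinearEquiv.toLinearMap_injective (rotation_zero hp)
  map_mul' θ η := LinearEquiv.toLinearMap_injective (rotation_comp hp θ.toAdd η.toAdd).symm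

theorem coe_rotationHom {p : SymMat} (hp : p ∉ L) (θ : ℝ) :
    (rotationHom hp (Multiplicative.ofAdd θ) : V →ₗ[ℝ] V) = rotation p θ := rfl

theorem rotationHom_two_pi {p : SymMat} (hp : p ∉ L) :
    rotationHom hp (Multiplicative.ofAdd (2 * Real.pi)) = 1 := by
  refine LinearEquiv.toLinearMap_injective ?_
  rw [coe_rotationHom]
  change _ = LinearMap.id
  rw [← rotation_zero hp]
  refine LinearMap.ext fun v => ?_
  simp [rotation_apply, rotate]

theorem rotationHom_pi_ne_one {p : SymMat} (hp : p ∉ L) :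
    rotationHom hp (Multiplicative.ofAdd Real.pi) ≠ 1 := by
  intro h
  have h1 : rotation p Real.pi (ofComponents (chart p) ![1, 0, 0])
      = ofComponents (chart p) ![1, 0, 0] := by
    rw [← coe_rotationHom hp, h]; rfl
  have h2 := congrArg (frameComponents (chart p)) h1
  rw [frameComponents_rotation hp, frameComponents_ofComponents ((notMem_L_iff _).1 hp)] at h2
  have h3 := congrFun h2 0
  norm_num [rotate] at h3

/-- If the transports are the multiples of one rotation of finite order, they form a cyclic group. -/
theorem holonomyGroup_of_loopTransports {p : SymMat} (hp : p ∉ L) {U : Set SymMat} {α : ℝ} {n : ℕ}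
    (hT : ∀ T : V ≃ₗ[ℝ] V, T ∈ loopTransports U p ↔
      ∃ k : ℤ, (T : V →ₗ[ℝ] V) = rotation p (k * α))
    (hn : orderOf (rotationHom hp (Multiplicative.ofAdd α)) = n) :
    (holonomyGroup U p : Set (V ≃ₗ[ℝ] V)) = loopTransports U p ∧
      (∀ T : V ≃ₗ[ℝ] V, T ∈ holonomyGroup U p ↔
        ∃ k : ℤ, (T : V →ₗ[ℝ] V) = rotation p (k * α)) ∧
      Nonempty (holonomyGroup U p ≃* Multiplicative (ZMod n)) := by
  set g := rotationHom hp (Multiplicative.ofAdd α)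
  -- The transports of single loops already form a cyclic subgroup, so taking the generated subgroup
  -- adds nothing.
  have hz : loopTransports U p = Subgroup.zpowers g := by
    ext T
    rw [hT, SetLike.mem_coe, Subgroup.mem_zpowers_iff]
    refine exists_congr fun k => ?_
    rw [← map_zpow, ← ofAdd_zsmul, zsmul_eq_mul, ← coe_rotationHom hp,
      LinearEquiv.toLinearMap_inj, eq_comm]
  have hH : holonomyGroup U p = Subgroup.zpowers g := by
    rw [holonomyGroup, hz, Subgroup.closure_eq]
  refine ⟨by rw [hH, hz], fun T => by rw [← hT, hH, hz, SetLike.mem_coe], ?_⟩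
  rw [hH, ← hn, ← Nat.card_zpowers]
  exact ⟨(zmodCyclicMulEquiv inferInstance).symm⟩

theorem mem_loopTransports_iff {p : SymMat} (hp : p ∉ L) {U : Set SymMat} (T : V ≃ₗ[ℝ] V) :
    T ∈ loopTransports U p ↔ ∃ γ, IsLoopAt p γ ∧ (∀ t ∈ Icc (0 : ℝ) 1, γ t ∈ U) ∧
      (T : V →ₗ[ℝ] V) = rotation p (sweptAngle γ 1 / 2) :=
  exists_congr fun _ => and_congr_right fun h => and_congr_right fun _ =>
    h.isParallelTransport_iff hp _

theorem mem_loopTransports_compl_iff {p : SymMat} (hp : p ∉ L) (T : V ≃ₗ[ℝ] V) :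
    T ∈ loopTransports Lᶜ p ↔ ∃ k : ℤ, (T : V →ₗ[ℝ] V) = rotation p (k * Real.pi) := by
  rw [mem_loopTransports_iff hp]
  constructor
  · rintro ⟨γ, h, hU, hT⟩
    obtain ⟨k, hk⟩ := h.sweptAngle_of_avoids hp hU
    exact ⟨k, hk ▸ hT⟩
  · rintro ⟨k, hT⟩
    obtain ⟨γ, h, hU, hk⟩ := exists_loop_avoiding hp k
    exact ⟨γ, h, hU, hk ▸ hT⟩

theorem mem_loopTransports_univ_iff {p : SymMat} (hp : p ∉ L) (T : V ≃ₗ[ℝ] V) :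
    T ∈ loopTransports univ p ↔ ∃ k : ℤ, (T : V →ₗ[ℝ] V) = rotation p (k * (Real.pi / 2)) := by
  rw [mem_loopTransports_iff hp]
  constructor
  · rintro ⟨γ, h, -, hT⟩
    obtain ⟨k, hk⟩ := h.exists_sweptAngle_eq hp
    exact ⟨k, hk ▸ hT⟩
  · rintro ⟨k, hT⟩
    obtain ⟨γ, h, hk⟩ := exists_loop hp k
    exact ⟨γ, h, fun _ _ => mem_univ _, hk ▸ hT⟩

theorem orderOf_rotationHom_pi {p : SymMat} (hp : p ∉ L) :
    orderOf (rotationHom hp (Multiplicative.ofAdd Real.pi)) = 2 := by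
  refine orderOf_eq_prime_pow (p := 2) (n := 0) ?_ ?_
  · simpa using rotationHom_pi_ne_one hp
  · rw [← map_pow, ← ofAdd_nsmul, nsmul_eq_mul]
    simpa using rotationHom_two_pi hp

/-- The square is rotation by `π`, which is not the identity, and the fourth power is rotation by
`2π`. -/
theorem orderOf_rotationHom_half_pi {p : SymMat} (hp : p ∉ L) :
    orderOf (rotationHom hp (Multiplicative.ofAdd (Real.pi / 2))) = 4 := by
  refine orderOf_eq_prime_pow (p := 2) (n := 1) ?_ ?_
  · rw [← map_pow, ← ofAdd_nsmul, nsmul_eq_mul]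
    convert rotationHom_pi_ne_one hp using 4
    push_cast
    ring
  · rw [← map_pow, ← ofAdd_nsmul, nsmul_eq_mul]
    convert rotationHom_two_pi hp using 3
    push_cast
    ring

end SymHol

end

theorem mainTheorem6 (p : SymHol.SymMat) (hp : p ∉ SymHol.L) :
    -- the holonomy of a loop is the rotation by `π` times its winding number around `L`
    (∀ γ : ℝ → SymHol.SymMat, SymHol.IsLoopAt p γ →
      IntervalIntegrable (fun t => SymHol.dphi (SymHol.chartCurve γ t) (SymHol.velocity γ t))
        MeasureTheory.volume 0 1 ∧
      ∀ T : SymHol.V →ₗ[ℝ] SymHol.V, SymHol.IsParallelTransport γ T ↔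
        T = SymHol.rotation p (Real.pi * SymHol.windingNumber γ)) ∧
    -- the holonomy group of `Sym(2,ℝ) ∖ L`
    ((SymHol.holonomyGroup SymHol.Lᶜ p : Set (SymHol.V ≃ₗ[ℝ] SymHol.V)) =
        SymHol.loopTransports SymHol.Lᶜ p ∧
      (∀ T : SymHol.V ≃ₗ[ℝ] SymHol.V, T ∈ SymHol.holonomyGroup SymHol.Lᶜ p ↔
        ∃ k : ℤ, (T : SymHol.V →ₗ[ℝ] SymHol.V) = SymHol.rotation p (k * Real.pi)) ∧
      Nonempty (SymHol.holonomyGroup SymHol.Lᶜ p ≃* Multiplicative (ZMod 2))) ∧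
    -- the holonomy group of `Sym(2,ℝ)`
    ((SymHol.holonomyGroup Set.univ p : Set (SymHol.V ≃ₗ[ℝ] SymHol.V)) =
        SymHol.loopTransports Set.univ p ∧
      (∀ T : SymHol.V ≃ₗ[ℝ] SymHol.V, T ∈ SymHol.holonomyGroup Set.univ p ↔
        ∃ k : ℤ, (T : SymHol.V →ₗ[ℝ] SymHol.V) = SymHol.rotation p (k * (Real.pi / 2))) ∧
      Nonempty (SymHol.holonomyGroup Set.univ p ≃* Multiplicative (ZMod 4))) := by
  refine ⟨fun γ h => ⟨h.intervalIntegrable hp (by simp) (by simp), fun T => ?_⟩,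
    SymHol.holonomyGroup_of_loopTransports hp (SymHol.mem_loopTransports_compl_iff hp)
      (SymHol.orderOf_rotationHom_pi hp),
    SymHol.holonomyGroup_of_loopTransports hp (SymHol.mem_loopTransports_univ_iff hp)
      (SymHol.orderOf_rotationHom_half_pi hp)⟩
  rw [SymHol.IsLoopAt.pi_mul_windingNumber]
  exact h.isParallelTransport_iff hp T
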